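/- **Theorem.** Let $x:\Sigma^2\to\mathbb{R}^3$ be a translator with non-empty boundary: $\Sigma$ is a connected smooth surface with $\partial\Sigma\neq\emptyset$, and $x$ is a smooth immersion whose induced metric $g=x^*\langle\cdot,\cdot\rangle$ is complete and which satisfies $\mathbf{H}=e_3^{\perp}$, where $\mathbf H$ is the mean curvature vector (the trace of the vector-valued second fundamental form) and $(\cdot)^\perp$ is the projection onto the normal space. Assume that $\Sigma$ is (Neumann) parabolic, that is, every $u\in C^0(\Sigma)\cap W^{1,2}_{\mathrm{loc}}(\mathrm{int}\,\Sigma)$ with $\sup_\Sigma u<+\infty$ which satisfies $\Delta u\ge 0$ in $\mathrm{int}\,\Sigma$ and $\partial u/\partial\eta\le 0$ on $\partial\Sigma$ ($\eta$ the outward unit conormal) in the weak sense, i.e. for every $0\le\varphi\in C_c^\infty(\Sigma)$ the function $g(\nabla u,\nabla\varphi)$ is integrable and $\int_\Sigma g(\nabla u,\nabla\varphi)\,d\mathrm{vol}_\Sigma\le 0$, is constant. Suppose that $x(\Sigma)$ is contained in a vertical slab $\{y\in\mathbb{R}^3: b\le\langle n,y\rangle\le b+\omega\}$ of width $\omega$,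 where $n$ is a horizontal unit vector ($|n|=1$, $\langle n,e_3\rangle=0$) and $b\in\mathbb{R}$. If, for some $a,c\in\mathbb{R}$, $x(\Sigma)\subseteq\{x_3\le a\}$ and $x(\partial\Sigma)$ is contained in the straight line $\{x_1=c\}\cap\{x_3=a\}$, then $x(\Sigma)$ is contained in the vertical plane $\{x_1=c\}$, and this plane is parallel to the slab, i.e. $n=\pm e_1$. In other words, $\Sigma$ is a piece of a vertical plane parallel to the slab. -/

import Mathlib

open MeasureTheory Set Filter Topology
open scoped Manifold ContDiff

noncomputable section

namespace Translator

/-- The Euclidean plane, in which coordinates of surfaces take their values. -/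
abbrev E2 : Type := EuclideanSpace ℝ (Fin 2)

/-- Euclidean three-space. The coordinates `x₁, x₂, x₃` of a point `y` are `y 0, y 1, y 2`. -/
abbrev E3 : Type := EuclideanSpace ℝ (Fin 3)

/-- The `i`-th standard basis vector of three-space (`stdVec 0 = e₁`, `stdVec 2 = e₃`). -/
def stdVec (i : Fin 3) : E3 := EuclideanSpace.single i 1

/-- The closed vertical slab of width `width` that is orthogonal to the horizontal unit vector `n`. -/
def verticalSlab (n : E3) (b width : ℝ) : Set E3 :=
  {y | b ≤ inner ℝ n y ∧ inner ℝ n y ≤ b + width}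

/-- The `i`-th coordinate derivative of a function of two coordinates `y` that is defined on
(a relatively open part of) the closed half-plane `range (𝓡∂ 2)`. At interior points of the
half-plane this is the usual partial derivative, at boundary points it is taken from inside. -/
def coordDeriv {F : Type*} [NormedAddCommGroup F] [NormedSpace ℝ F]
    (X : E2 → F) (i : Fin 2) (y : E2) : F :=
  fderivWithin ℝ X (range (𝓡∂ 2)) y (EuclideanSpace.single i 1)

variable {M : Type*} [TopologicalSpace M] [ChartedSpace (EuclideanHalfSpace 2) M]

/-- A map on the surface, read in the preferred chart around `p`. -/
def inChart {F : Type*} (f : M → F) (p : M) (y : E2) : F :=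
  f ((extChartAt (𝓡∂ 2) p).symm y)

/-- The part of the image of the preferred chart around `p` that corresponds to points of
`int M`; it is an open subset of the plane. -/
def interiorTarget (p : M) : Set E2 :=
  (extChartAt (𝓡∂ 2) p).target ∩ interior (range (𝓡∂ 2))

/-- The matrix `g_ij = ⟨∂ᵢx, ∂ⱼx⟩` of the induced metric `x^*⟨·,·⟩` in the preferred chart
around `p`. -/
def metricMatrix (x : M → E3) (p : M) (y : E2) : Matrix (Fin 2) (Fin 2) ℝ :=
  Matrix.of fun i j => inner ℝ (coordDeriv (inChart x p) i y) (coordDeriv (inChart x p) j y)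

/-! ### Extrinsic geometry -/

/-- The tangent plane of the immersed surface at `p`, as a linear subspace of three-space. -/
def tangentPlane (x : M → E3) (p : M) : Submodule ℝ E3 :=
  Submodule.span ℝ (range fun i => coordDeriv (inChart x p) i (extChartAt (𝓡∂ 2) p p))

/-- The projection `v ↦ v^⊥` onto the normal space of the immersed surface at `p`. -/
def normalPart (x : M → E3) (p : M) (v : E3) : E3 :=
  (tangentPlane x p)ᗮ.starProjection v

/-- The coefficients `A_ij = (∂ᵢ∂ⱼ x)^⊥` of the (vector-valued) second fundamental form at `p`. -/
def secondFundamentalForm (x : M → E3) (p : M) (i j : Fin 2) : E3 :=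
  normalPart x p (coordDeriv (coordDeriv (inChart x p) j) i (extChartAt (𝓡∂ 2) p p))

/-- The mean curvature vector `𝐇 = tr 𝐀 = g^ij A_ij` at `p`. -/
def meanCurvatureVector (x : M → E3) (p : M) : E3 :=
  ∑ i, ∑ j, (metricMatrix x p (extChartAt (𝓡∂ 2) p p))⁻¹ i j • secondFundamentalForm x p i j

/-- The length `|dx(v)|` of a tangent vector `v` in the metric induced by `x`. -/
def tangentLength (x : M → E3) (r : M) (v : TangentSpace (𝓡∂ 2) r) : ENNReal :=
  let dxv : E3 := mfderiv (𝓡∂ 2) 𝓘(ℝ, E3) x r v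
  ‖dxv‖ₑ

/-- The intrinsic distance of the metric induced by `x`: the infimum of the lengths
`∫ |dx(γ')|` of `C¹` paths `γ` in `M` from `p` to `q`. -/
def intrinsicEDist (x : M → E3) (p q : M) : ENNReal :=
  letI : ∀ r : M, ENorm (TangentSpace (𝓡∂ 2) r) :=
    fun r => ⟨tangentLength x r⟩
  Manifold.riemannianEDist (𝓡∂ 2) p q

/-- Completeness of the induced metric: intrinsic Cauchy sequences converge in `M`. -/
def IsCompleteImmersion (x : M → E3) : Prop :=
  ∀ s : ℕ → M,
    (∀ ε : ENNReal, 0 < ε → ∃ N, ∀ k, N ≤ k → ∀ l, N ≤ l → intrinsicEDist x (s k) (s l) < ε) →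
    ∃ q, Tendsto s atTop (𝓝 q)

/-- `x : M → ℝ³` is a translator (with possibly non-empty boundary): a smooth complete immersion
satisfying `𝐇 = e₃^⊥`. Connectedness of `M` is a separate hypothesis. -/
structure IsTranslator (x : M → E3) : Prop where
  smooth : ContMDiff (𝓡∂ 2) 𝓘(ℝ, E3) ∞ x
  immersion : ∀ p, Function.Injective (mfderiv (𝓡∂ 2) 𝓘(ℝ, E3) x p)
  complete : IsCompleteImmersion x
  meanCurvature_eq : ∀ p, meanCurvatureVector x p = normalPart x p (stdVec 2)

/-! ### Neumann parabolicity -/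

/-- `w` is the weak gradient of `v` on the open set `U` of the plane, and it is locally square
integrable in `U`. For continuous `v` this says `v ∈ W^{1,2}_loc(U)`. -/
structure IsWeakGradient (U : Set E2) (v : E2 → ℝ) (w : E2 → E2) : Prop where
  memLp : ∀ K, K ⊆ U → IsCompact K → MemLp w 2 (volume.restrict K)
  integral_eq : ∀ ψ : E2 → ℝ, ContDiff ℝ ∞ ψ → HasCompactSupport ψ → tsupport ψ ⊆ U →
    ∀ i : Fin 2, ∫ y in U, v y * fderiv ℝ ψ y (EuclideanSpace.single i 1)
      = - ∫ y in U, w y i * ψ y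

/-- The integrand `g(∇u, ∇φ) dvol = g^ij (∂ᵢu) (∂ⱼφ) √(det g)` in the preferred chart around `p`,
where `w` is the coordinate gradient of `u` and `φ` is smooth. -/
def gradPairing (x : M → E3) (p : M) (w : E2 → E2) (φ : M → ℝ) (y : E2) : ℝ :=
  (∑ i, ∑ j, (metricMatrix x p y)⁻¹ i j * w y i * coordDeriv (inChart φ p) j y)
    * √((metricMatrix x p y).det)

/-- `u ∈ W^{1,2}_loc(int M)` and, in the weak sense, `Δu ≥ 0` in `int M` and `∂u/∂η ≤ 0` on `∂M`:
`∫_M g(∇u, ∇φ) dvol ≤ 0` for all `0 ≤ φ ∈ C_c^∞(M)`, where `φ` need not vanish on `∂M`.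
By a partition of unity it suffices to test with `φ` supported in the domain of one of the
preferred charts (which cover `M`), and then the integral is computed in that chart. -/
def IsWeakNeumannSubharmonic (x : M → E3) (u : M → ℝ) : Prop :=
  ∀ p : M, ∃ w : E2 → E2, IsWeakGradient (interiorTarget p) (inChart u p) w ∧
    ∀ φ : M → ℝ, ContMDiff (𝓡∂ 2) 𝓘(ℝ, ℝ) ∞ φ → HasCompactSupport φ →
      tsupport φ ⊆ (chartAt (EuclideanHalfSpace 2) p).source → (∀ q, 0 ≤ φ q) →
      IntegrableOn (gradPairing x p w φ) (interiorTarget p) ∧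
        ∫ y in interiorTarget p, gradPairing x p w φ y ≤ 0

/-- (Neumann) parabolicity of `M` with the metric induced by `x`. -/
def IsNeumannParabolic (x : M → E3) : Prop :=
  ∀ u : M → ℝ, Continuous u → IsWeakNeumannSubharmonic x u → BddAbove (range u) →
    ∃ k : ℝ, ∀ p, u p = k

end Translator

end

/-!
Write `f = x₁ - c` and let `P` be the orthogonal projection onto the normal space. There are two
steps.

*The slab is parallel to `e₂`.* The boundary is mapped to the line `{x₁ = c, x₃ = a}`, and an
immersion restricts to a local isometry of the boundary into that line. If `x₂` were bounded above
on `∂M`, then moving along the boundary in the direction of increasing `x₂` would give, by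
completeness, a boundary point beyond which `x₂` cannot be increased, although `x₂` is a local
coordinate of the boundary. This is phrased with the order
`d(p, q) ≤ x₂(q) - x₂(p)` on `∂M`, see `not_bddAbove_of_exists_increase`, `exists_boundary_curve`
and `not_bddAbove_boundary`; no global parametrization of the boundary is needed. On the
boundary `⟨n, x⟩ = n₁ c + n₂ x₂` is bounded, so `n₂ = 0` and `n = ±e₁`, see
`normal_eq_of_subset_slab`.

*The barrier `u = f² e^{x₃}`.* Since `Δ_g x = e₃^⊥`, one computes
`Δ_g u = e^{x₃} (f² - 2 f ⟨P e₁, e₃⟩ + 2 (1 - ⟨P e₁, e₁⟩))`, and this is nonnegative because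
`⟨P e₁, e₃⟩² ≤ 1 - ⟨P e₁, e₁⟩`; see `divergence_barrier_nonneg`. As `n = ±e₁`, the function `x₁` is
bounded, and so is `u` because `x₃ ≤ a`. Moreover `u` is smooth and vanishes to second order on
`∂M`, so that it satisfies the Neumann condition, see `isWeakNeumannSubharmonic_barrier`.
Parabolicity makes `u` constant, and `u = 0` on `∂M ≠ ∅`; hence `f = 0` everywhere.

The equation `Δ_g x = 𝐇 = e₃^⊥` is used in divergence form: the fields
`√(det g) g^{ji} ∂_i x` (`conormalField`) have divergence `√(det g) g^{ij} (∂_i ∂_j x)^⊥`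
(`divergence_conormalField`), and the mean curvature vector, defined at each point through the chart
around that point, can be computed in any chart (`meanCurvatureVector_inChart`).
-/

namespace Translator

/-! ### Calculus on the half-plane -/

/-- A relatively open subset of the closed half-plane in which charts of the surface take their
values. -/
structure IsRelOpen (T : Set E2) : Prop where
  subset : T ⊆ range (𝓡∂ 2)
  mem_nhdsWithin : ∀ y ∈ T, T ∈ 𝓝[range (𝓡∂ 2)] y

lemma mem_halfPlane {y : E2} : y ∈ range (𝓡∂ 2) ↔ 0 ≤ y 0 := by
  rw [range_modelWithCornersEuclideanHalfSpace]; rfl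

lemma mem_interior_halfPlane {y : E2} : y ∈ interior (range (𝓡∂ 2)) ↔ 0 < y 0 := by
  rw [interior_range_modelWithCornersEuclideanHalfSpace]; rfl

lemma coordDeriv_eq_fderiv {F : Type*} [NormedAddCommGroup F] [NormedSpace ℝ F]
    (X : E2 → F) (i : Fin 2) {y : E2} (hy : y ∈ interior (range (𝓡∂ 2))) :
    coordDeriv X i y = fderiv ℝ X y (EuclideanSpace.single i 1) := by
  rw [coordDeriv, fderivWithin_of_mem_nhds (mem_interior_iff_mem_nhds.1 hy)]

namespace IsRelOpen

variable {T : Set E2} {F : Type*} [NormedAddCommGroup F] [NormedSpace ℝ F]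

lemma uniqueDiffOn (hT : IsRelOpen T) : UniqueDiffOn ℝ T := fun y hy =>
  (((𝓡∂ 2).uniqueDiffOn y (hT.subset hy)).inter' (hT.mem_nhdsWithin y hy)).mono inter_subset_right

lemma mem_nhds (hT : IsRelOpen T) {y : E2} (hy : y ∈ T) (hy' : y ∈ interior (range (𝓡∂ 2))) :
    T ∈ 𝓝 y := by
  have h := hT.mem_nhdsWithin y hy
  rwa [nhdsWithin_eq_nhds.2 (mem_interior_iff_mem_nhds.1 hy')] at h

lemma isOpen_inter_interior (hT : IsRelOpen T) : IsOpen (T ∩ interior (range (𝓡∂ 2))) :=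
  isOpen_iff_mem_nhds.2 fun _ hy =>
    inter_mem (hT.mem_nhds hy.1 hy.2) (isOpen_interior.mem_nhds hy.2)

lemma coordDeriv_eq (hT : IsRelOpen T) (X : E2 → F) (i : Fin 2) {y : E2} (hy : y ∈ T) :
    coordDeriv X i y = fderivWithin ℝ X T y (EuclideanSpace.single i 1) := by
  have h : range (𝓡∂ 2) =ᶠ[𝓝 y] T := by
    filter_upwards [mem_nhdsWithin_iff_eventually.1 (hT.mem_nhdsWithin y hy)] with z hz
    exact propext ⟨hz, fun h => hT.subset h⟩
  rw [coordDeriv, fderivWithin_congr_set h]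

lemma contDiffOn_coordDeriv (hT : IsRelOpen T) {X : E2 → F} (hX : ContDiffOn ℝ ∞ X T)
    (i : Fin 2) : ContDiffOn ℝ ∞ (coordDeriv X i) T := by
  refine ContDiffOn.congr ?_ fun y hy => hT.coordDeriv_eq X i hy
  exact (hX.fderivWithin hT.uniqueDiffOn (by simp)).clm_apply contDiffOn_const

lemma contDiffAt (hT : IsRelOpen T) {X : E2 → F} {m : WithTop ℕ∞} (hX : ContDiffOn ℝ m X T)
    {y : E2} (hy : y ∈ T) (hy' : y ∈ interior (range (𝓡∂ 2))) : ContDiffAt ℝ m X y :=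
  hX.contDiffAt (hT.mem_nhds hy hy')

lemma coordDeriv_eq_zero (hT : IsRelOpen T) {X : E2 → F} {K : Set E2} (hK : IsClosed K)
    (hX : ∀ y ∈ T \ K, X y = 0) (i : Fin 2) {y : E2} (hy : y ∈ T \ K) :
    coordDeriv X i y = 0 := by
  have h : X =ᶠ[𝓝[range (𝓡∂ 2)] y] fun _ => (0 : F) := by
    filter_upwards [hT.mem_nhdsWithin y hy.1,
      mem_nhdsWithin_of_mem_nhds (hK.isOpen_compl.mem_nhds hy.2)] with z h1 h2 using hX z ⟨h1, h2⟩
  rw [coordDeriv, h.fderivWithin_eq (hX y hy)]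
  simp

lemma integrableOn {F : Type*} [NormedAddCommGroup F] (hT : IsRelOpen T)
    {X : E2 → F} {K : Set E2} (hK : IsCompact K) (hKT : K ⊆ T)
    (hc : ContinuousOn X T) (hX : ∀ y ∈ T \ K, X y = 0) :
    IntegrableOn X (T ∩ interior (range (𝓡∂ 2))) :=
  ((hc.mono hKT).integrableOn_compact hK).of_forall_sdiff_eq_zero
    hT.isOpen_inter_interior.measurableSet fun y hy => hX y ⟨hy.1.1, hy.2⟩

lemma continuousOn_indicator {F : Type*} [NormedAddCommGroup F]
    (hT : IsRelOpen T) {X : E2 → F} {K : Set E2} (hK : IsClosed K)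
    (hc : ContinuousOn X T) (hX : ∀ y ∈ T \ K, X y = 0) (hKT : K ⊆ T) :
    ContinuousOn (T.indicator X) (range (𝓡∂ 2)) := by
  intro y hy
  by_cases hyT : y ∈ T
  · have h1 : ContinuousWithinAt X (range (𝓡∂ 2)) y :=
      (hc y hyT).mono_of_mem_nhdsWithin (hT.mem_nhdsWithin y hyT)
    refine h1.congr_of_eventuallyEq ?_ (indicator_of_mem hyT X)
    filter_upwards [hT.mem_nhdsWithin y hyT] with z hz using indicator_of_mem hz X
  · have hyK : y ∉ K := fun h => hyT (hKT h)
    have h0 : ∀ z ∉ K, T.indicator X z = 0 := fun z hz => by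
      by_cases h : z ∈ T
      · rw [indicator_of_mem h, hX z ⟨h, hz⟩]
      · exact indicator_of_notMem h X
    refine (continuousWithinAt_const (b := (0 : F))).congr_of_eventuallyEq ?_ (h0 y hyK)
    filter_upwards [mem_nhdsWithin_of_mem_nhds (hK.isOpen_compl.mem_nhds hyK)] with z hz
      using h0 z hz

end IsRelOpen

/-- The divergence theorem on the open half-plane for a field that is supported in a ball,
continuous up to the boundary line and tangent to that line. Differentiability is only needed in the
open half-plane, as in the divergence theorem on boxes, which gives the result. -/
lemma integral_divergence_halfPlane_eq_zero (V : Fin 2 → E2 → ℝ) {R : ℝ} (hR : 0 < R)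
    (hsupp : ∀ i y, R ≤ ‖y‖ → V i y = 0)
    (hc : ∀ i, ContinuousOn (V i) (range (𝓡∂ 2)))
    (hbd : ∀ y : E2, y 0 = 0 → V 0 y = 0)
    (hd : ∀ i, ∀ y ∈ interior (range (𝓡∂ 2)), DifferentiableAt ℝ (V i) y)
    (hi : IntegrableOn (fun y => ∑ i, fderiv ℝ (V i) y (EuclideanSpace.single i 1))
      (interior (range (𝓡∂ 2)))) :
    ∫ y in interior (range (𝓡∂ 2)),
      ∑ i, fderiv ℝ (V i) y (EuclideanSpace.single i 1) = 0 := by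
  set d : E2 → ℝ := fun y => ∑ i, fderiv ℝ (V i) y (EuclideanSpace.single i 1)
  -- a box containing the support in its interior, with one face on the boundary line
  let eL : E2 ≃L[ℝ] (Fin 2 → ℝ) := EuclideanSpace.equiv (Fin 2) ℝ
  let a : Fin 2 → ℝ := ![0, -(R + 1)]
  let b : Fin 2 → ℝ := ![R + 1, R + 1]
  have hab : a ≤ b := by
    intro i; fin_cases i
    · simp [a, b]; linarith
    · simp [a, b]; linarith
  have hsub : ∀ z ∈ pi univ fun i => Ioo (a i) (b i), eL.symm z ∈ interior (range (𝓡∂ 2)) := by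
    intro z hz
    rw [mem_interior_halfPlane]
    exact (hz 0 trivial).1
  have hd0 : ∀ y ∈ interior (range (𝓡∂ 2)), R < ‖y‖ → d y = 0 := by
    intro y hy hRy
    have h : ∀ i, V i =ᶠ[𝓝 y] fun _ => (0 : ℝ) := fun i => by
      filter_upwards [continuous_norm.continuousAt.eventually (lt_mem_nhds hRy)] with z hz
        using hsupp i z (le_of_lt hz)
    refine Finset.sum_eq_zero fun i _ => ?_
    rw [(h i).fderiv_eq]
    simp
  -- the divergence, read in the model `Fin 2 → ℝ`
  have hmp : MeasurePreserving (eL.symm : (Fin 2 → ℝ) → E2) := PiLp.volume_preserving_toLp (Fin 2)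
  have hme : MeasurableEmbedding (eL.symm : (Fin 2 → ℝ) → E2) :=
    eL.symm.toHomeomorph.measurableEmbedding
  have hae : Icc a b =ᵐ[volume] pi univ fun i => Ioo (a i) (b i) :=
    (Measure.univ_pi_Ioo_ae_eq_Icc (f := a) (g := b)).symm
  have hio : IntegrableOn (fun z => d (eL.symm z)) (pi univ fun i => Ioo (a i) (b i)) := by
    have h := (hmp.integrableOn_comp_preimage hme (f := d)
      (s := interior (range (𝓡∂ 2)))).2 hi
    exact h.mono_set hsub
  have hdiv := integral_divergence_of_hasFDerivAt_off_countable' a b hab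
    (fun i z => V i (eL.symm z))
    (fun i z => (fderiv ℝ (V i) (eL.symm z)).comp (eL.symm : (Fin 2 → ℝ) →L[ℝ] E2)) ∅
    countable_empty ?_ ?_ ?_
  · have hsum : (fun z : Fin 2 → ℝ => ∑ i, ((fderiv ℝ (V i) (eL.symm z)).comp
        (eL.symm : (Fin 2 → ℝ) →L[ℝ] E2)) (Pi.single i 1)) = fun z => d (eL.symm z) := by
      funext z
      rfl
    rw [hsum] at hdiv
    have hfaces : ∫ z in Icc a b, d (eL.symm z) = 0 := by
      rw [hdiv]
      refine Finset.sum_eq_zero fun i _ => ?_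
      have hfront : ∀ t : Fin 1 → ℝ, V i (eL.symm (i.insertNth (b i) t)) = 0 := fun t => by
        refine hsupp i _ (le_trans ?_ (PiLp.norm_apply_le _ i))
        have h : (eL.symm (i.insertNth (b i) t)) i = b i := 
          @Fin.insertNth_apply_same 1 (fun _ => ℝ) i (b i) t
        rw [h, Real.norm_eq_abs]
        refine le_trans ?_ (le_abs_self _)
        fin_cases i <;> simp [b]
      have hback : ∀ t : Fin 1 → ℝ, V i (eL.symm (i.insertNth (a i) t)) = 0 := fun t => by
        have h : (eL.symm (i.insertNth (a i) t)) i = a i := 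
          @Fin.insertNth_apply_same 1 (fun _ => ℝ) i (a i) t
        fin_cases i
        · exact hbd _ h
        · refine hsupp 1 _ (le_trans ?_ (PiLp.norm_apply_le _ 1))
          refine le_trans ?_ (neg_le_abs _)
          rw [show (eL.symm _) 1 = a 1 from h]
          simp [a]
      simp only [hfront, hback]
      simp
    rw [setIntegral_congr_set hae] at hfaces
    rw [← hmp.setIntegral_preimage_emb hme, ← hfaces]
    refine (setIntegral_eq_of_subset_of_forall_sdiff_eq_zero
      (isOpen_interior.measurableSet.preimage hme.measurable) hsub fun z hz => ?_)
    refine hd0 _ hz.1 ?_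
    by_contra hlt
    have hle : ∀ i, |z i| ≤ R := fun i =>
      (PiLp.norm_apply_le (eL.symm z) i).trans (not_lt.1 hlt)
    refine hz.2 fun i _ => ?_
    have h0 : 0 < z 0 := mem_interior_halfPlane.1 hz.1
    have h2 := abs_le.1 (hle i)
    fin_cases i
    · exact ⟨h0, by simp [b]; simp at h2; linarith⟩
    · exact ⟨by simp [a]; simp at h2; linarith, by simp [b]; simp at h2; linarith⟩
  · intro i
    refine (hc i).comp eL.symm.continuous.continuousOn fun z hz => ?_
    rw [mem_halfPlane]
    exact hz.1 0
  · intro z hz i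
    exact ((hd i _ (hsub z hz.1)).hasFDerivAt).comp z eL.symm.hasFDerivAt
  · exact (integrableOn_congr_set_ae hae).2 hio

/-- The divergence theorem for a vector field on a relatively open subset of the half-plane that is
smooth up to the boundary line, has compact support, and whose normal component vanishes on the
boundary line: there is no boundary term. -/
lemma IsRelOpen.integral_divergence_eq_zero {T : Set E2} (hT : IsRelOpen T)
    (V : Fin 2 → E2 → ℝ) {K : Set E2} (hK : IsCompact K) (hKT : K ⊆ T)
    (hV : ∀ i, ContDiffOn ℝ ∞ (V i) T) (hsupp : ∀ i, ∀ y ∈ T \ K, V i y = 0)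
    (hbd : ∀ y ∈ T, y 0 = 0 → V 0 y = 0) :
    ∫ y in T ∩ interior (range (𝓡∂ 2)), ∑ i, coordDeriv (V i) i y = 0 := by
  obtain ⟨R, hR⟩ := hK.isBounded.subset_ball 0
  have hR' : K ⊆ Metric.ball 0 (max R 1) := hR.trans (Metric.ball_subset_ball (le_max_left _ _))
  -- the field is extended by zero to the half-plane
  let W : Fin 2 → E2 → ℝ := fun i => T.indicator (V i)
  have hW0 : ∀ i, ∀ y ∉ K, W i y = 0 := fun i y hy => by
    by_cases h : y ∈ T
    · exact (indicator_of_mem h _).trans (hsupp i y ⟨h, hy⟩)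
    · exact indicator_of_notMem h _
  have hWV : ∀ i, ∀ y ∈ T ∩ interior (range (𝓡∂ 2)), W i =ᶠ[𝓝 y] V i := fun i y hy => by
    filter_upwards [hT.mem_nhds hy.1 hy.2] with z hz using indicator_of_mem hz _
  have hWz : ∀ i, ∀ y ∉ K, W i =ᶠ[𝓝 y] fun _ => (0 : ℝ) := fun i y hy => by
    filter_upwards [hK.isClosed.isOpen_compl.mem_nhds hy] with z hz using hW0 i z hz
  have hdiv : ∀ y ∈ T ∩ interior (range (𝓡∂ 2)),
      ∑ i, fderiv ℝ (W i) y (EuclideanSpace.single i 1) = ∑ i, coordDeriv (V i) i y :=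
    fun y hy => Finset.sum_congr rfl fun i _ => by
      rw [(hWV i y hy).fderiv_eq, coordDeriv_eq_fderiv _ _ hy.2]
  have hdiv0 : ∀ y ∉ K, ∑ i, fderiv ℝ (W i) y (EuclideanSpace.single i 1) = 0 :=
    fun y hy => Finset.sum_eq_zero fun i _ => by
      rw [(hWz i y hy).fderiv_eq]
      simp
  have hint : IntegrableOn (fun y => ∑ i, fderiv ℝ (W i) y (EuclideanSpace.single i 1))
      (interior (range (𝓡∂ 2))) := by
    have h1 : IntegrableOn (fun y => ∑ i, coordDeriv (V i) i y)
        (T ∩ interior (range (𝓡∂ 2))) :=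
      hT.integrableOn hK hKT
        (continuousOn_finsetSum _ fun i _ => (hT.contDiffOn_coordDeriv (hV i) i).continuousOn)
        fun y hy => Finset.sum_eq_zero fun i _ =>
          hT.coordDeriv_eq_zero hK.isClosed (hsupp i) i hy
    refine ((integrableOn_congr_fun hdiv hT.isOpen_inter_interior.measurableSet).2
      h1).of_forall_sdiff_eq_zero isOpen_interior.measurableSet fun y hy => hdiv0 y fun h => ?_
    exact hy.2 ⟨hKT h, hy.1⟩
  have hmain := integral_divergence_halfPlane_eq_zero W (R := max R 1)
    (lt_of_lt_of_le one_pos (le_max_right _ _)) ?_ ?_ ?_ ?_ hint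
  · rw [← hmain, ← setIntegral_congr_fun hT.isOpen_inter_interior.measurableSet hdiv]
    refine (setIntegral_eq_of_subset_of_forall_sdiff_eq_zero isOpen_interior.measurableSet
      inter_subset_right fun y hy => hdiv0 y fun h => ?_).symm
    exact hy.2 ⟨hKT h, hy.1⟩
  · intro i y hy
    refine hW0 i y fun h => ?_
    have := hR' h
    rw [mem_ball_zero_iff] at this
    linarith
  · exact fun i => hT.continuousOn_indicator hK.isClosed (hV i).continuousOn (hsupp i) hKT
  · intro y hy
    by_cases h : y ∈ T
    · exact (indicator_of_mem h _).trans (hbd y h hy)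
    · exact indicator_of_notMem h _
  · intro i y hy
    by_cases h : y ∈ T
    · exact ((hT.contDiffAt (hV i) h hy).differentiableAt (by simp)).congr_of_eventuallyEq
        (hWV i y ⟨h, hy⟩)
    · exact (differentiableAt_const _).congr_of_eventuallyEq (hWz i y fun hK => h (hKT hK))

/-! ### Preferred charts -/

section Charts

variable {M : Type*} [TopologicalSpace M] [ChartedSpace (EuclideanHalfSpace 2) M]

lemma isRelOpen_target (p : M) : IsRelOpen (extChartAt (𝓡∂ 2) p).target where
  subset := extChartAt_target_subset_range p
  mem_nhdsWithin _ hy := extChartAt_target_mem_nhdsWithin_of_mem hy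

variable [IsManifold (𝓡∂ 2) ∞ M] {F : Type*} [NormedAddCommGroup F] [NormedSpace ℝ F]

lemma contDiffOn_inChart {f : M → F} (hf : ContMDiff (𝓡∂ 2) 𝓘(ℝ, F) ∞ f) (p : M) :
    ContDiffOn ℝ ∞ (inChart f p) (extChartAt (𝓡∂ 2) p).target :=
  contMDiffOn_iff_contDiffOn.1
    (hf.comp_contMDiffOn (contMDiffOn_extChartAt_symm (I := 𝓡∂ 2) (n := ∞) p))

/-- Boundary points are recognized in any preferred chart: being a boundary point does not depend
on the chart. -/
lemma mem_boundary_iff {p q : M} (hq : q ∈ (extChartAt (𝓡∂ 2) p).source) :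
    q ∈ (𝓡∂ 2).boundary M ↔ extChartAt (𝓡∂ 2) p q 0 = 0 := by
  have hy := (extChartAt (𝓡∂ 2) p).map_source hq
  rw [extChartAt_source] at hq
  rw [← (𝓡∂ 2).compl_interior, mem_compl_iff, ModelWithCorners.interior, mem_ofPred_eq,
    (𝓡∂ 2).isInteriorPoint_iff_of_mem_atlas (n := ∞) (by simp) (chart_mem_atlas _ p) hq]
  have h0 : 0 ≤ extChartAt (𝓡∂ 2) p q 0 :=
    mem_halfPlane.1 (extChartAt_target_subset_range p hy)
  have key : (chartAt (EuclideanHalfSpace 2) p).extend (𝓡∂ 2) q ∈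
      interior ((chartAt (EuclideanHalfSpace 2) p).extend (𝓡∂ 2)).target ↔
      extChartAt (𝓡∂ 2) p q ∈ interior (range (𝓡∂ 2)) := by
    constructor
    · exact fun h => interior_mono (extChartAt_target_subset_range p) h
    · exact fun h => mem_interior_iff_mem_nhds.2 ((isRelOpen_target p).mem_nhds hy h)
  rw [key, mem_interior_halfPlane]
  exact ⟨fun h => le_antisymm (not_lt.1 h) h0, fun h => by rw [h]; exact lt_irrefl _⟩

lemma symm_mem_boundary_iff {p : M} {y : E2} (hy : y ∈ (extChartAt (𝓡∂ 2) p).target) :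
    (extChartAt (𝓡∂ 2) p).symm y ∈ (𝓡∂ 2).boundary M ↔ y 0 = 0 := by
  rw [mem_boundary_iff ((extChartAt (𝓡∂ 2) p).map_target hy), (extChartAt (𝓡∂ 2) p).right_inv hy]

lemma injective_fderivWithin_inChart {f : M → F} (hf : ContMDiff (𝓡∂ 2) 𝓘(ℝ, F) ∞ f)
    (hinj : ∀ p, Function.Injective (mfderiv (𝓡∂ 2) 𝓘(ℝ, F) f p)) {p : M} {y : E2}
    (hy : y ∈ (extChartAt (𝓡∂ 2) p).target) :
    Function.Injective (fderivWithin ℝ (inChart f p) (range (𝓡∂ 2)) y) := by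
  have hs := mdifferentiableWithinAt_extChartAt_symm (I := 𝓡∂ 2) hy
  have hF : MDifferentiableAt (𝓡∂ 2) 𝓘(ℝ, F) f ((extChartAt (𝓡∂ 2) p).symm y) :=
    hf.mdifferentiableAt (by simp)
  have h := mfderiv_comp_mfderivWithin y hF hs
    ((𝓡∂ 2).uniqueMDiffOn y ((isRelOpen_target p).subset hy))
  rw [mfderivWithin_eq_fderivWithin] at h
  change Function.Injective (fderivWithin ℝ (f ∘ (extChartAt (𝓡∂ 2) p).symm) (range (𝓡∂ 2)) y)
  rw [h]
  exact (hinj _).comp (isInvertible_mfderivWithin_extChartAt_symm (I := 𝓡∂ 2) hy).injective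

/-- If `y` are the coordinates of an interior point `q` in the preferred chart around `p`, then near
`y` a function read in the chart around `p` is the function read in the chart around `q`, composed
with a smooth change of coordinates `τ`. -/
lemma exists_transition {F : Type*} (f : M → F) {p : M} {y : E2} (hy : y ∈ interiorTarget p) :
    let q := (extChartAt (𝓡∂ 2) p).symm y
    extChartAt (𝓡∂ 2) q q ∈ interior (range (𝓡∂ 2)) ∧
    ∃ τ : E2 → E2, ContDiffAt ℝ ∞ τ y ∧ τ y = extChartAt (𝓡∂ 2) q q ∧
      inChart f p =ᶠ[𝓝 y] inChart f q ∘ τ := by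
  intro q
  have hq : q ∈ (extChartAt (𝓡∂ 2) p).source := (extChartAt (𝓡∂ 2) p).map_target hy.1
  have hqq : q ∈ (extChartAt (𝓡∂ 2) q).source := mem_extChartAt_source q
  constructor
  · have h0 : 0 ≤ extChartAt (𝓡∂ 2) q q 0 :=
      mem_halfPlane.1 (extChartAt_target_subset_range q (mem_extChartAt_target q))
    rw [mem_interior_halfPlane]
    refine lt_of_le_of_ne h0 fun h => ?_
    have h1 := (symm_mem_boundary_iff hy.1).1 ((mem_boundary_iff hqq).2 h.symm)
    exact (mem_interior_halfPlane.1 hy.2).ne' h1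
  · refine ⟨extChartAt (𝓡∂ 2) q ∘ (extChartAt (𝓡∂ 2) p).symm, ?_, rfl, ?_⟩
    · have h := contDiffWithinAt_ext_coord_change (I := 𝓡∂ 2) (n := ∞) q p (y := y) ?_
      · exact h.contDiffAt (mem_interior_iff_mem_nhds.1 hy.2)
      · exact ⟨hy.1, hqq⟩
    · have hc : ContinuousAt (extChartAt (𝓡∂ 2) p).symm y := by
        have := continuousAt_extChartAt_symm'' (I := 𝓡∂ 2) hy.1
        exact this
      filter_upwards [hc.eventually (extChartAt_source_mem_nhds (I := 𝓡∂ 2) q)] with z hz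
      simp only [inChart, Function.comp_apply]
      rw [(extChartAt (𝓡∂ 2) q).left_inv hz]

end Charts

/-! ### The divergence of the conormal fields of a frame -/

section Projection

variable {a b : E3} {K : Submodule ℝ E3}

open scoped InnerProductSpace

lemma gram_det_pos (hab : LinearIndependent ℝ ![a, b]) :
    0 < ⟪a, a⟫_ℝ * ⟪b, b⟫_ℝ - ⟪a, b⟫_ℝ ^ 2 := by
  have ha : a ≠ 0 := hab.ne_zero 0
  have h1 : 0 < ⟪a, a⟫_ℝ := real_inner_self_pos.2 ha
  -- the component of `b` orthogonal to `a`, scaled by `⟪a, a⟫`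
  have h2 : ⟪a, a⟫_ℝ • b - ⟪a, b⟫_ℝ • a ≠ 0 := by
    intro h
    have := LinearIndependent.pair_iff.1 hab (-⟪a, b⟫_ℝ) ⟪a, a⟫_ℝ (by rw [← h]; module)
    exact h1.ne' this.2
  have h3 := real_inner_self_pos.2 h2
  simp only [inner_sub_left, inner_sub_right, inner_smul_left, inner_smul_right,
    real_inner_comm a b, RCLike.conj_to_real] at h3
  have h4 : 0 < ⟪a, a⟫_ℝ * (⟪a, a⟫_ℝ * ⟪b, b⟫_ℝ - ⟪a, b⟫_ℝ ^ 2) := by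
    convert h3 using 1
    ring
  exact pos_of_mul_pos_right h4 h1.le

lemma mem_orthogonal_span_pair {v : E3} (hK : K = Submodule.span ℝ {a, b})
    (ha : ⟪v, a⟫_ℝ = 0) (hb : ⟪v, b⟫_ℝ = 0) : v ∈ Kᗮ := by
  rw [Submodule.mem_orthogonal', hK]
  intro u hu
  obtain ⟨s, t, rfl⟩ := Submodule.mem_span_pair.1 hu
  simp [inner_add_right, inner_smul_right, ha, hb]

/-- The inner product splits into a normal part and a tangential part, the latter written with the
inverse of the Gram matrix of the basis `a, b` of the tangent plane `K`. -/
lemma inner_eq_normal_add_tangential (hab : LinearIndependent ℝ ![a, b])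
    (hK : K = Submodule.span ℝ {a, b}) (u v : E3) :
    (⟪a, a⟫_ℝ * ⟪b, b⟫_ℝ - ⟪a, b⟫_ℝ ^ 2) * (⟪u, v⟫_ℝ - ⟪Kᗮ.starProjection u, v⟫_ℝ) =
      ⟪a, u⟫_ℝ * (⟪b, b⟫_ℝ * ⟪a, v⟫_ℝ - ⟪a, b⟫_ℝ * ⟪b, v⟫_ℝ)
        + ⟪b, u⟫_ℝ * (⟪a, a⟫_ℝ * ⟪b, v⟫_ℝ - ⟪a, b⟫_ℝ * ⟪a, v⟫_ℝ) := by
  have hD := (gram_det_pos hab).ne'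
  set D := ⟪a, a⟫_ℝ * ⟪b, b⟫_ℝ - ⟪a, b⟫_ℝ ^ 2 with hDdef
  set t : E3 := D⁻¹ • ((⟪b, b⟫_ℝ * ⟪a, u⟫_ℝ - ⟪a, b⟫_ℝ * ⟪b, u⟫_ℝ) • a
    + (⟪a, a⟫_ℝ * ⟪b, u⟫_ℝ - ⟪a, b⟫_ℝ * ⟪a, u⟫_ℝ) • b) with ht
  have hc := real_inner_comm a b
  have hta : ⟪u - t, a⟫_ℝ = 0 := by
    simp only [ht, inner_sub_left, inner_add_left, inner_smul_left, RCLike.conj_to_real, hc,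
      real_inner_comm a u]
    field_simp
    rw [hDdef]
    ring
  have htb : ⟪u - t, b⟫_ℝ = 0 := by
    simp only [ht, inner_sub_left, inner_add_left, inner_smul_left, RCLike.conj_to_real,
      real_inner_comm b u]
    field_simp
    rw [hDdef]
    ring
  have htK : t ∈ K := by
    rw [hK]
    exact Submodule.smul_mem _ _ (Submodule.mem_span_pair.2 ⟨_, _, rfl⟩)
  have hP : Kᗮ.starProjection u = u - t :=
    (Submodule.eq_starProjection_of_mem_orthogonal (mem_orthogonal_span_pair hK hta htb)
      (by rwa [sub_sub_cancel, Submodule.orthogonal_orthogonal]))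
  rw [hP, inner_sub_left]
  simp only [ht, inner_add_left, inner_smul_left, RCLike.conj_to_real]
  field_simp
  ring

/-- If `e`, `e'` are orthonormal, then `⟨e^⊥, e'⟩² ≤ 1 - ⟨e^⊥, e⟩`: the left-hand side is
the inner product of `e'` with the tangential part of `e`, whose squared length is the
right-hand side. -/
lemma sq_inner_starProjection_le {e e' : E3} (he : ‖e‖ = 1) (he' : ‖e'‖ = 1)
    (hee : ⟪e, e'⟫_ℝ = 0) :
    ⟪Kᗮ.starProjection e, e'⟫_ℝ ^ 2 ≤ 1 - ⟪Kᗮ.starProjection e, e⟫_ℝ := by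
  have h1 : ⟪Kᗮ.starProjection e, e'⟫_ℝ = -⟪e - Kᗮ.starProjection e, e'⟫_ℝ := by
    rw [inner_sub_left, hee]; ring
  have h2 : ‖e - Kᗮ.starProjection e‖ ^ 2 = 1 - ⟪Kᗮ.starProjection e, e⟫_ℝ := by
    have h3 : ⟪e - Kᗮ.starProjection e, Kᗮ.starProjection e⟫_ℝ = 0 :=
      Submodule.starProjection_inner_eq_zero e _ (Submodule.starProjection_apply_mem _ _)
    rw [← real_inner_self_eq_norm_sq]
    rw [inner_sub_right, h3, inner_sub_left, real_inner_self_eq_norm_sq, he]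
    ring
  rw [h1, neg_sq, ← h2, ← sq_abs]
  have := abs_real_inner_le_norm (e - Kᗮ.starProjection e) e'
  rw [he', mul_one] at this
  gcongr

end Projection

section Conormal

variable {a b : E2 → E3} {y : E2} {K : Submodule ℝ E3}

open scoped InnerProductSpace

/-- The determinant of the Gram matrix of two vector fields. -/
noncomputable def gramDet (a b : E2 → E3) (z : E2) : ℝ :=
  ⟪a z, a z⟫_ℝ * ⟪b z, b z⟫_ℝ - ⟪a z, b z⟫_ℝ ^ 2

/-- For a frame `a, b` of a surface with Gram matrix `g`, the vector field `√(det g) g^{1i} X_i`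
with `X₁ = a`, `X₂ = b`. The field `√(det g) g^{2i} X_i` is `conormalField b a`. -/
noncomputable def conormalField (a b : E2 → E3) (z : E2) : E3 :=
  (√(gramDet a b z))⁻¹ • (⟪b z, b z⟫_ℝ • a z - ⟪a z, b z⟫_ℝ • b z)

lemma gramDet_comm (a b : E2 → E3) (z : E2) : gramDet b a z = gramDet a b z := by
  rw [gramDet, gramDet, real_inner_comm (a z) (b z)]; ring

lemma inner_conormalField_left (a b : E2 → E3) (z : E2) :
    ⟪conormalField a b z, a z⟫_ℝ = √(gramDet a b z) := by
  have h : ⟪conormalField a b z, a z⟫_ℝ = (√(gramDet a b z))⁻¹ * gramDet a b z := by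
    simp only [conormalField, inner_smul_left, inner_sub_left, RCLike.conj_to_real, gramDet]
    rw [real_inner_comm (a z) (b z)]
    ring
  rw [h, ← div_eq_inv_mul, Real.div_sqrt]

lemma inner_conormalField_right (a b : E2 → E3) (z : E2) :
    ⟪conormalField a b z, b z⟫_ℝ = 0 := by
  simp only [conormalField, inner_smul_left, inner_sub_left, RCLike.conj_to_real]
  ring

variable (ha : DifferentiableAt ℝ a y) (hb : DifferentiableAt ℝ b y)
include ha hb

lemma differentiableAt_gramDet : DifferentiableAt ℝ (gramDet a b) y :=
  ((ha.inner ℝ ha).mul (hb.inner ℝ hb)).sub ((ha.inner ℝ hb).pow 2)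

lemma fderiv_gramDet (e : E2) :
    fderiv ℝ (gramDet a b) y e = 2 * ⟪a y, fderiv ℝ a y e⟫_ℝ * ⟪b y, b y⟫_ℝ
      + 2 * ⟪a y, a y⟫_ℝ * ⟪b y, fderiv ℝ b y e⟫_ℝ
      - 2 * ⟪a y, b y⟫_ℝ * (⟪a y, fderiv ℝ b y e⟫_ℝ + ⟪b y, fderiv ℝ a y e⟫_ℝ) := by
  have h := (((ha.inner ℝ ha).hasFDerivAt.mul (hb.inner ℝ hb).hasFDerivAt).sub
    ((ha.inner ℝ hb).hasFDerivAt.pow 2)).fderiv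
  change fderiv ℝ (gramDet a b) y = _ at h
  rw [h]
  simp only [FunLike.coe_sub, Pi.sub_apply, add_apply, smul_apply,
    fderiv_inner_apply ℝ ha ha, fderiv_inner_apply ℝ hb hb, fderiv_inner_apply ℝ ha hb, smul_eq_mul]
  rw [real_inner_comm (a y) (fderiv ℝ a y e), real_inner_comm (b y) (fderiv ℝ b y e),
    real_inner_comm (b y) (fderiv ℝ a y e)]
  ring

lemma differentiableAt_conormalField (hD : 0 < gramDet a b y) :
    DifferentiableAt ℝ (conormalField a b) y :=
  (((differentiableAt_gramDet ha hb).sqrt hD.ne').inv (Real.sqrt_pos.2 hD).ne').smul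
    (((hb.inner ℝ hb).smul ha).sub ((ha.inner ℝ hb).smul hb))

/-- The normal part of a derivative of the conormal field: the derivatives of its coefficients only
contribute tangential terms. -/
lemma starProjection_fderiv_conormalField (hD : 0 < gramDet a b y)
    (hK : K = Submodule.span ℝ {a y, b y}) (e : E2) :
    Kᗮ.starProjection (fderiv ℝ (conormalField a b) y e) = (√(gramDet a b y))⁻¹ •
      (⟪b y, b y⟫_ℝ • Kᗮ.starProjection (fderiv ℝ a y e)
        - ⟪a y, b y⟫_ℝ • Kᗮ.starProjection (fderiv ℝ b y e)) := by
  have hPa : Kᗮ.starProjection (a y) = 0 := Submodule.starProjection_orthogonal_apply_eq_zero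
    (hK ▸ Submodule.subset_span (by simp))
  have hPb : Kᗮ.starProjection (b y) = 0 := Submodule.starProjection_orthogonal_apply_eq_zero
    (hK ▸ Submodule.subset_span (by simp))
  have h := ((((differentiableAt_gramDet ha hb).sqrt hD.ne').inv
    (Real.sqrt_pos.2 hD).ne').hasFDerivAt.smul
    (((hb.inner ℝ hb).hasFDerivAt.smul ha.hasFDerivAt).sub
      ((ha.inner ℝ hb).hasFDerivAt.smul hb.hasFDerivAt))).fderiv
  change fderiv ℝ (conormalField a b) y = _ at h
  rw [h]
  simp only [add_apply, smul_apply, sub_apply, ContinuousLinearMap.smulRight_apply,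
    map_add, map_smul, map_sub, hPa, hPb, Pi.sub_apply, Pi.smul_apply', smul_zero, sub_zero,
    add_zero, Pi.inv_apply]

/-- Obtained by differentiating `⟪W, a⟫ = √(det g)` for the conormal field `W`. -/
lemma inner_fderiv_conormalField_left (hD : 0 < gramDet a b y) (e : E2) :
    ⟪fderiv ℝ (conormalField a b) y e, a y⟫_ℝ =
      (√(gramDet a b y))⁻¹ * (⟪a y, a y⟫_ℝ * ⟪b y, fderiv ℝ b y e⟫_ℝ
        - ⟪a y, b y⟫_ℝ * ⟪a y, fderiv ℝ b y e⟫_ℝ) := by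
  have h1 := fderiv_inner_apply ℝ (differentiableAt_conormalField ha hb hD) ha e
  simp only [inner_conormalField_left] at h1
  rw [fderiv_sqrt (differentiableAt_gramDet ha hb) hD.ne'] at h1
  have h2 : ⟪conormalField a b y, fderiv ℝ a y e⟫_ℝ = (√(gramDet a b y))⁻¹ *
      (⟪b y, b y⟫_ℝ * ⟪a y, fderiv ℝ a y e⟫_ℝ - ⟪a y, b y⟫_ℝ * ⟪b y, fderiv ℝ a y e⟫_ℝ) := by
    simp [conormalField, inner_smul_left, inner_sub_left]
  simp only [smul_apply, fderiv_gramDet ha hb, smul_eq_mul, h2] at h1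
  have hS := (Real.sqrt_pos.2 hD).ne'
  field_simp at h1 ⊢
  linarith

/-- Obtained by differentiating `⟪W, b⟫ = 0` for the conormal field `W`. -/
lemma inner_fderiv_conormalField_right (hD : 0 < gramDet a b y) (e : E2) :
    ⟪fderiv ℝ (conormalField a b) y e, b y⟫_ℝ =
      -((√(gramDet a b y))⁻¹ * (⟪b y, b y⟫_ℝ * ⟪a y, fderiv ℝ b y e⟫_ℝ
        - ⟪a y, b y⟫_ℝ * ⟪b y, fderiv ℝ b y e⟫_ℝ)) := by
  have h1 := fderiv_inner_apply ℝ (differentiableAt_conormalField ha hb hD) hb e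
  simp only [inner_conormalField_right] at h1
  have h2 : ⟪conormalField a b y, fderiv ℝ b y e⟫_ℝ = (√(gramDet a b y))⁻¹ *
      (⟪b y, b y⟫_ℝ * ⟪a y, fderiv ℝ b y e⟫_ℝ - ⟪a y, b y⟫_ℝ * ⟪b y, fderiv ℝ b y e⟫_ℝ) := by
    simp [conormalField, inner_smul_left, inner_sub_left]
  rw [← h2]
  simp at h1
  linarith

/-- The formula `Δ_g X = g^{ij} (∂_i ∂_j X)^⊥` in divergence form: for a frame `a = ∂₁X`, `b = ∂₂X`
of coordinate vector fields (so that `∂₂a = ∂₁b`), the divergence of the fields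
`√(det g) g^{ji} X_i` is normal and only involves the normal parts of second derivatives. -/
lemma divergence_conormalField (hab : LinearIndependent ℝ ![a y, b y])
    (hK : K = Submodule.span ℝ {a y, b y}) {e₁ e₂ : E2}
    (hsymm : fderiv ℝ a y e₂ = fderiv ℝ b y e₁) :
    fderiv ℝ (conormalField a b) y e₁ + fderiv ℝ (conormalField b a) y e₂ =
      (√(gramDet a b y))⁻¹ • (⟪b y, b y⟫_ℝ • Kᗮ.starProjection (fderiv ℝ a y e₁)
        - ⟪a y, b y⟫_ℝ • Kᗮ.starProjection (fderiv ℝ b y e₁)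
        - ⟪a y, b y⟫_ℝ • Kᗮ.starProjection (fderiv ℝ a y e₂)
        + ⟪a y, a y⟫_ℝ • Kᗮ.starProjection (fderiv ℝ b y e₂)) := by
  have hD : 0 < gramDet a b y := gram_det_pos hab
  have hD' : 0 < gramDet b a y := by rwa [gramDet_comm]
  have hK' : K = Submodule.span ℝ {b y, a y} := by rw [hK, Set.pair_comm]
  -- the tangential part vanishes, so the divergence equals its normal part
  have hmem : fderiv ℝ (conormalField a b) y e₁ + fderiv ℝ (conormalField b a) y e₂ ∈ Kᗮ := by
    refine mem_orthogonal_span_pair hK ?_ ?_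
    · rw [inner_add_left, inner_fderiv_conormalField_left ha hb hD,
        inner_fderiv_conormalField_right hb ha hD', gramDet_comm, hsymm,
        real_inner_comm (a y) (b y)]
      ring
    · rw [inner_add_left, inner_fderiv_conormalField_right ha hb hD,
        inner_fderiv_conormalField_left hb ha hD', gramDet_comm, hsymm,
        real_inner_comm (a y) (b y)]
      ring
  rw [← Submodule.starProjection_eq_self_iff.2 hmem, map_add,
    starProjection_fderiv_conormalField ha hb hD hK,
    starProjection_fderiv_conormalField hb ha hD' hK', gramDet_comm, real_inner_comm (a y) (b y)]
  module

end Conormal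

/-! ### Subharmonicity of the barrier function -/

section Subharmonic

variable {X a b : E2 → E3} {y : E2} {K : Submodule ℝ E3}

open scoped InnerProductSpace

lemma inner_stdVec_left (i : Fin 3) (v : E3) : ⟪stdVec i, v⟫_ℝ = v i := by
  simp [stdVec, EuclideanSpace.inner_single_left]

lemma inner_stdVec_right (i : Fin 3) (v : E3) : ⟪v, stdVec i⟫_ℝ = v i := by
  rw [real_inner_comm, inner_stdVec_left]

lemma norm_stdVec (i : Fin 3) : ‖stdVec i‖ = 1 := by simp [stdVec]

/-- For vectors `u`, `v`, the fields `W₁ = conormalField a b` and `W₂ = conormalField b a` compute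
the inner product of the tangential parts of `u` and `v`, multiplied by `√(det g)`. -/
lemma inner_conormalField_add (hab : LinearIndependent ℝ ![a y, b y])
    (hK : K = Submodule.span ℝ {a y, b y}) (u v : E3) :
    ⟪a y, u⟫_ℝ * ⟪conormalField a b y, v⟫_ℝ + ⟪b y, u⟫_ℝ * ⟪conormalField b a y, v⟫_ℝ =
      √(gramDet a b y) * (⟪u, v⟫_ℝ - ⟪Kᗮ.starProjection u, v⟫_ℝ) := by
  have hD : 0 < gramDet a b y := gram_det_pos hab
  have h := inner_eq_normal_add_tangential hab hK u v
  have hS := (Real.sqrt_pos.2 hD).ne'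
  have hS2 : √(gramDet a b y) * √(gramDet a b y) = gramDet a b y := Real.mul_self_sqrt hD.le
  simp only [conormalField, gramDet_comm, inner_smul_left, inner_sub_left, RCLike.conj_to_real,
    real_inner_comm (a y) (b y)]
  change gramDet a b y * _ = _ at h
  rw [← hS2] at h
  field_simp
  linarith

/-- The gradient of the function `(x₁ - c)² e^{x₃}` on three-space. -/
noncomputable def barrierGradient (c : ℝ) (v : E3) : E3 :=
  Real.exp (v 2) • ((2 * (v 0 - c)) • stdVec 0 + (v 0 - c) ^ 2 • stdVec 2)

lemma contDiff_coord (i : Fin 3) : ContDiff ℝ ∞ fun v : E3 => v i :=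
  (EuclideanSpace.proj i : E3 →L[ℝ] ℝ).contDiff

lemma contDiff_barrier (c : ℝ) : ContDiff ℝ ∞ fun v : E3 => (v 0 - c) ^ 2 * Real.exp (v 2) :=
  (((contDiff_coord 0).sub contDiff_const).pow 2).mul (contDiff_coord 2).exp

lemma contDiff_barrierGradient (c : ℝ) : ContDiff ℝ ∞ (barrierGradient c) :=
  (contDiff_coord 2).exp.smul
    (((contDiff_const.mul ((contDiff_coord 0).sub contDiff_const)).smul contDiff_const).add
      ((((contDiff_coord 0).sub contDiff_const).pow 2).smul contDiff_const))

lemma hasFDerivAt_coord (i : Fin 3) (v : E3) :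
    HasFDerivAt (fun v : E3 => v i) (EuclideanSpace.proj i : E3 →L[ℝ] ℝ) v :=
  (EuclideanSpace.proj i : E3 →L[ℝ] ℝ).hasFDerivAt

lemma fderiv_barrier (c : ℝ) (v w : E3) :
    fderiv ℝ (fun v : E3 => (v 0 - c) ^ 2 * Real.exp (v 2)) v w = ⟪barrierGradient c v, w⟫_ℝ := by
  have h := ((((hasFDerivAt_coord 0 v).sub_const c).pow 2).mul
    (hasFDerivAt_coord 2 v).exp).fderiv
  change fderiv ℝ (fun v : E3 => (v 0 - c) ^ 2 * Real.exp (v 2)) v = _ at h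
  rw [h]
  simp [barrierGradient, inner_smul_left, inner_add_left, inner_stdVec_left]
  ring

lemma fderiv_barrierGradient (c : ℝ) (v w : E3) :
    fderiv ℝ (barrierGradient c) v w = Real.exp (v 2) •
      ((2 * (v 0 - c) * w 2 + 2 * w 0) • stdVec 0
        + ((v 0 - c) ^ 2 * w 2 + 2 * (v 0 - c) * w 0) • stdVec 2) := by
  have h := ((hasFDerivAt_coord 2 v).exp.smul
    (((((hasFDerivAt_coord 0 v).sub_const c).const_mul 2).smul_const (stdVec 0)).add
      ((((hasFDerivAt_coord 0 v).sub_const c).pow 2).smul_const (stdVec 2)))).fderiv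
  change fderiv ℝ (barrierGradient c) v = _ at h
  rw [h]
  simp
  module

/-- On a translator, `(x₁ - c)² e^{x₃}` is subharmonic. With `f = x₁ - c` and the normal projection
`P`, its Laplacian is `e^{x₃} (f² - 2 f ⟨P e₁, e₃⟩ + 2 (1 - ⟨P e₁, e₁⟩))`, which is nonnegative
since `⟨P e₁, e₃⟩² ≤ 1 - ⟨P e₁, e₁⟩`. -/
lemma divergence_barrier_nonneg (c : ℝ) (hab : LinearIndependent ℝ ![a y, b y])
    (hK : K = Submodule.span ℝ {a y, b y}) (hX : DifferentiableAt ℝ X y)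
    (ha : DifferentiableAt ℝ a y) (hb : DifferentiableAt ℝ b y) {e₁ e₂ : E2}
    (hXa : fderiv ℝ X y e₁ = a y) (hXb : fderiv ℝ X y e₂ = b y)
    (hdiv : fderiv ℝ (conormalField a b) y e₁ + fderiv ℝ (conormalField b a) y e₂ =
      √(gramDet a b y) • Kᗮ.starProjection (stdVec 2)) :
    0 ≤ fderiv ℝ (fun z => ⟪conormalField a b z, barrierGradient c (X z)⟫_ℝ) y e₁
      + fderiv ℝ (fun z => ⟪conormalField b a z, barrierGradient c (X z)⟫_ℝ) y e₂ := by
  have hD : 0 < gramDet a b y := gram_det_pos hab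
  have hA := differentiableAt_conormalField ha hb hD
  have hB := differentiableAt_conormalField hb ha (by rwa [gramDet_comm])
  have hGX : DifferentiableAt ℝ (barrierGradient c) (X y) :=
    (contDiff_barrierGradient c).differentiable (by simp) _
  have hG : DifferentiableAt ℝ (fun z => barrierGradient c (X z)) y := hGX.comp y hX
  have hGd : ∀ e, fderiv ℝ (fun z => barrierGradient c (X z)) y e =
      fderiv ℝ (barrierGradient c) (X y) (fderiv ℝ X y e) := fun e => by
    have := fderiv_comp y hGX hX
    change fderiv ℝ (fun z => barrierGradient c (X z)) y = _ at this
    rw [this]; rfl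
  rw [fderiv_inner_apply ℝ hA hG, fderiv_inner_apply ℝ hB hG, hGd, hGd, hXa, hXb,
    fderiv_barrierGradient, fderiv_barrierGradient]
  have hsum : ⟪fderiv ℝ (conormalField a b) y e₁, barrierGradient c (X y)⟫_ℝ
      + ⟪fderiv ℝ (conormalField b a) y e₂, barrierGradient c (X y)⟫_ℝ =
      √(gramDet a b y) * ⟪Kᗮ.starProjection (stdVec 2), barrierGradient c (X y)⟫_ℝ := by
    rw [← inner_add_left, hdiv, inner_smul_left, RCLike.conj_to_real]
  have h00 := inner_conormalField_add hab hK (stdVec 0) (stdVec 0)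
  have h02 := inner_conormalField_add hab hK (stdVec 0) (stdVec 2)
  have h20 := inner_conormalField_add hab hK (stdVec 2) (stdVec 0)
  have h22 := inner_conormalField_add hab hK (stdVec 2) (stdVec 2)
  have hs : ⟪Kᗮ.starProjection (stdVec 2), stdVec 0⟫_ℝ =
      ⟪Kᗮ.starProjection (stdVec 0), stdVec 2⟫_ℝ := by
    rw [Submodule.inner_starProjection_left_eq_right, real_inner_comm]
  have hle := sq_inner_starProjection_le (K := K) (norm_stdVec 0) (norm_stdVec 2)
    (by rw [inner_stdVec_left]; simp [stdVec])
  have e00 : ⟪stdVec 0, stdVec 0⟫_ℝ = 1 := by rw [inner_stdVec_left]; simp [stdVec]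
  have e02 : ⟪stdVec 0, stdVec 2⟫_ℝ = 0 := by rw [inner_stdVec_left]; simp [stdVec]
  have e20 : ⟪stdVec 2, stdVec 0⟫_ℝ = 0 := by rw [inner_stdVec_left]; simp [stdVec]
  have e22 : ⟪stdVec 2, stdVec 2⟫_ℝ = 1 := by rw [inner_stdVec_left]; simp [stdVec]
  rw [e00, inner_stdVec_right, inner_stdVec_right] at h00
  rw [e02, inner_stdVec_right, inner_stdVec_right] at h02
  rw [hs, e20, inner_stdVec_right, inner_stdVec_right] at h20
  rw [e22, inner_stdVec_right, inner_stdVec_right] at h22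
  set S := √(gramDet a b y)
  set p00 := ⟪Kᗮ.starProjection (stdVec 0), stdVec 0⟫_ℝ
  set p02 := ⟪Kᗮ.starProjection (stdVec 0), stdVec 2⟫_ℝ
  set p22 := ⟪Kᗮ.starProjection (stdVec 2), stdVec 2⟫_ℝ
  set f := X y 0 - c
  have hS : 0 ≤ S := Real.sqrt_nonneg _
  have hE := (Real.exp_pos (X y 2)).le
  set E := Real.exp (X y 2)
  have hval : ⟪Kᗮ.starProjection (stdVec 2), barrierGradient c (X y)⟫_ℝ =
      E * (2 * f * p02 + f ^ 2 * p22) := by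
    simp only [barrierGradient, inner_smul_right, inner_add_right, hs]
    rfl
  rw [hval] at hsum
  have hq : 0 ≤ f ^ 2 - 2 * f * p02 + 2 * (1 - p00) := by nlinarith [sq_nonneg (f - p02)]
  have : 0 ≤ S * E * (f ^ 2 - 2 * f * p02 + 2 * (1 - p00)) := by positivity
  convert this using 1
  simp only [inner_smul_right, inner_add_right, ← inner_stdVec_right]
  simp only [← inner_stdVec_right] at h00 h02 h20 h22
  linear_combination hsum + E * 2 * h00 + E * (2 * f) * h20 + E * (2 * f) * h02 + E * f ^ 2 * h22

end Subharmonic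

/-! ### Independence of the mean curvature vector of the chart -/

section ChartChange

lemma eq_sum_single (v : E2) :
    v = v 0 • EuclideanSpace.single 0 1 + v 1 • EuclideanSpace.single 1 1 := by
  ext i; fin_cases i <;> simp

lemma span_range_clm_single (L : E2 →L[ℝ] E3) :
    Submodule.span ℝ (range fun i : Fin 2 => L (EuclideanSpace.single i 1)) =
      LinearMap.range (L : E2 →ₗ[ℝ] E3) := by
  apply le_antisymm
  · rw [Submodule.span_le]
    rintro _ ⟨i, rfl⟩
    exact ⟨_, rfl⟩
  · rintro _ ⟨v, rfl⟩
    have h : (L : E2 →ₗ[ℝ] E3) v = v 0 • L (EuclideanSpace.single 0 1)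
        + v 1 • L (EuclideanSpace.single 1 1) := by
      conv_lhs => rw [eq_sum_single v]
      simp
    rw [h]
    exact Submodule.add_mem _ (Submodule.smul_mem _ _ (Submodule.subset_span ⟨0, rfl⟩))
      (Submodule.smul_mem _ _ (Submodule.subset_span ⟨1, rfl⟩))

/-- The matrix of inner products of the images of the coordinate vectors. -/
noncomputable def gramMatrix (L : E2 →L[ℝ] E3) : Matrix (Fin 2) (Fin 2) ℝ :=
  Matrix.of fun i j => inner ℝ (L (EuclideanSpace.single i 1)) (L (EuclideanSpace.single j 1))

lemma linearIndependent_of_injective {L : E2 →L[ℝ] E3} (hL : Function.Injective L) :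
    LinearIndependent ℝ ![L (EuclideanSpace.single 0 1), L (EuclideanSpace.single 1 1)] := by
  rw [LinearIndependent.pair_iff]
  intro s t h
  have h1 : L (s • EuclideanSpace.single 0 1 + t • EuclideanSpace.single 1 1) = L 0 := by
    simpa using h
  have h2 := hL h1
  have h3 := congrArg (fun v : E2 => v 0) h2
  have h4 := congrArg (fun v : E2 => v 1) h2
  simp at h3 h4
  exact ⟨h3, h4⟩

lemma det_gramMatrix_pos {L : E2 →L[ℝ] E3} (hL : Function.Injective L) :
    0 < (gramMatrix L).det := by
  have h := gram_det_pos (linearIndependent_of_injective hL)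
  rw [Matrix.det_fin_two]
  convert h using 1
  simp only [gramMatrix, Matrix.of_apply]
  rw [real_inner_comm (L (EuclideanSpace.single 0 1)) (L (EuclideanSpace.single 1 1))]
  ring

/-- The trace of a bilinear form with respect to the Gram matrix does not depend on the
coordinates. -/
lemma sum_gramMatrix_inv_comp {L : E2 →L[ℝ] E3} {J : E2 →L[ℝ] E2}
    (hLJ : Function.Injective (L.comp J)) (B : E2 →L[ℝ] E2 →L[ℝ] E3) :
    ∑ i, ∑ j, (gramMatrix (L.comp J))⁻¹ i j •
        B (J (EuclideanSpace.single i 1)) (J (EuclideanSpace.single j 1)) =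
      ∑ i, ∑ j, (gramMatrix L)⁻¹ i j •
        B (EuclideanSpace.single i 1) (EuclideanSpace.single j 1) := by
  set m : Matrix (Fin 2) (Fin 2) ℝ := Matrix.of fun k i => J (EuclideanSpace.single i 1) k
  have hJ : ∀ i, J (EuclideanSpace.single i 1) =
      m 0 i • EuclideanSpace.single 0 1 + m 1 i • EuclideanSpace.single 1 1 :=
    fun i => eq_sum_single _
  have hg : gramMatrix (L.comp J) = m.transpose * gramMatrix L * m := by
    ext i j
    simp only [gramMatrix, Matrix.of_apply, ContinuousLinearMap.comp_apply, Matrix.mul_apply,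
      Matrix.transpose_apply, Fin.sum_univ_two, hJ, map_add, map_smul, inner_add_left,
      inner_add_right, inner_smul_left, inner_smul_right, RCLike.conj_to_real]
    ring
  have hdet : (gramMatrix (L.comp J)).det ≠ 0 := (det_gramMatrix_pos hLJ).ne'
  rw [hg, Matrix.det_mul, Matrix.det_mul, Matrix.det_transpose] at hdet
  have hmdet : IsUnit m.det := isUnit_iff_ne_zero.2 (right_ne_zero_of_mul hdet)
  have hinv : (gramMatrix L)⁻¹ = m * (gramMatrix (L.comp J))⁻¹ * m.transpose := by
    rw [hg, Matrix.mul_inv_rev, Matrix.mul_inv_rev, ← Matrix.mul_assoc, ← Matrix.mul_assoc,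
      Matrix.mul_nonsing_inv _ hmdet, Matrix.one_mul, Matrix.mul_assoc,
      Matrix.nonsing_inv_mul _ (by rwa [Matrix.det_transpose]), Matrix.mul_one]
  rw [hinv]
  simp only [Matrix.mul_apply, Matrix.transpose_apply, Fin.sum_univ_two, hJ, map_add, map_smul,
    add_apply, smul_apply]
  module

/-- The chain rule for second derivatives. -/
lemma fderiv_fderiv_comp_apply {A : E2 → E3} {τ : E2 → E2} {y : E2}
    (hA : ContDiffAt ℝ ∞ A (τ y)) (hτ : ContDiffAt ℝ ∞ τ y) (v w : E2) :
    fderiv ℝ (fun z => fderiv ℝ (A ∘ τ) z w) y v =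
      fderiv ℝ (fderiv ℝ A) (τ y) (fderiv ℝ τ y v) (fderiv ℝ τ y w)
        + fderiv ℝ A (τ y) (fderiv ℝ (fun z => fderiv ℝ τ z w) y v) := by
  have hA1 : ∀ᶠ z in 𝓝 y, DifferentiableAt ℝ A (τ z) := by
    have h : ∀ᶠ u in 𝓝 (τ y), DifferentiableAt ℝ A u :=
      ((hA.of_le (m := 1) (by simp)).eventually (by simp)).mono
        fun u hu => hu.differentiableAt (by simp)
    exact hτ.continuousAt.eventually h
  have hτ1 : ∀ᶠ z in 𝓝 y, DifferentiableAt ℝ τ z :=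
    ((hτ.of_le (m := 1) (by simp)).eventually (by simp)).mono
      fun u hu => hu.differentiableAt (by simp)
  have h1 : (fun z => fderiv ℝ (A ∘ τ) z w) =ᶠ[𝓝 y]
      fun z => fderiv ℝ A (τ z) (fderiv ℝ τ z w) := by
    filter_upwards [hA1, hτ1] with z hz1 hz2
    rw [fderiv_comp z hz1 hz2]
    rfl
  have hDA : DifferentiableAt ℝ (fderiv ℝ A) (τ y) :=
    (hA.fderiv_right (m := ∞) (by simp)).differentiableAt (by simp)
  have hDτ : DifferentiableAt ℝ (fderiv ℝ τ) y :=
    (hτ.fderiv_right (m := ∞) (by simp)).differentiableAt (by simp)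
  have hτy : DifferentiableAt ℝ τ y := hτ.differentiableAt (by simp)
  have hc : HasFDerivAt (fun z => fderiv ℝ A (τ z))
      ((fderiv ℝ (fderiv ℝ A) (τ y)).comp (fderiv ℝ τ y)) y :=
    hDA.hasFDerivAt.comp y hτy.hasFDerivAt
  have hd : DifferentiableAt ℝ (fun z => fderiv ℝ τ z w) y :=
    hDτ.clm_apply (differentiableAt_const w)
  rw [h1.fderiv_eq, (hc.clm_apply hd.hasFDerivAt).fderiv]
  simp
  abel

variable {M : Type*} [TopologicalSpace M] [ChartedSpace (EuclideanHalfSpace 2) M]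

lemma coordDeriv_coordDeriv_eq (X : E2 → E3) (i j : Fin 2) {y : E2}
    (hy : y ∈ interior (range (𝓡∂ 2))) :
    coordDeriv (coordDeriv X j) i y = fderiv ℝ
      (fun z => fderiv ℝ X z (EuclideanSpace.single j 1)) y (EuclideanSpace.single i 1) := by
  have h : coordDeriv X j =ᶠ[𝓝 y] fun z => fderiv ℝ X z (EuclideanSpace.single j 1) := by
    filter_upwards [isOpen_interior.mem_nhds hy] with z hz using coordDeriv_eq_fderiv X j hz
  rw [coordDeriv_eq_fderiv _ _ hy, h.fderiv_eq]

lemma metricMatrix_eq_gramMatrix (x : M → E3) (p : M) {y : E2}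
    (hy : y ∈ interior (range (𝓡∂ 2))) :
    metricMatrix x p y = gramMatrix (fderiv ℝ (inChart x p) y) := by
  ext i j
  simp only [metricMatrix, gramMatrix, Matrix.of_apply, coordDeriv_eq_fderiv _ _ hy]

variable [IsManifold (𝓡∂ 2) ∞ M]

/-- The tangent plane and the mean curvature vector at the point with coordinates `y` in the
preferred chart around `p` can be computed in that chart. -/
lemma meanCurvatureVector_inChart {x : M → E3} (hx : ContMDiff (𝓡∂ 2) 𝓘(ℝ, E3) ∞ x)
    (hinj : ∀ p, Function.Injective (mfderiv (𝓡∂ 2) 𝓘(ℝ, E3) x p)) {p : M} {y : E2}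
    (hy : y ∈ interiorTarget p) :
    tangentPlane x ((extChartAt (𝓡∂ 2) p).symm y) =
      Submodule.span ℝ (range fun i => coordDeriv (inChart x p) i y) ∧
    meanCurvatureVector x ((extChartAt (𝓡∂ 2) p).symm y) =
      ∑ i, ∑ j, (metricMatrix x p y)⁻¹ i j •
        normalPart x ((extChartAt (𝓡∂ 2) p).symm y)
          (coordDeriv (coordDeriv (inChart x p) j) i y) := by
  obtain ⟨hz, τ, hτ, hτy, hXτ⟩ := exists_transition x hy
  set q := (extChartAt (𝓡∂ 2) p).symm y
  set z := extChartAt (𝓡∂ 2) q q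
  set X := inChart x p with hX
  set A := inChart x q
  have hAsm : ContDiffAt ℝ ∞ A (τ y) := by
    rw [hτy]
    exact (isRelOpen_target q).contDiffAt (contDiffOn_inChart hx q) (mem_extChartAt_target q) hz
  have hXinj : Function.Injective (fderiv ℝ X y) := by
    rw [← fderivWithin_of_mem_nhds (mem_interior_iff_mem_nhds.1 hy.2)]
    exact injective_fderivWithin_inChart hx hinj hy.1
  have hXd : fderiv ℝ X y = (fderiv ℝ A z).comp (fderiv ℝ τ y) := by
    rw [hXτ.fderiv_eq, fderiv_comp y (hAsm.differentiableAt (by simp))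
      (hτ.differentiableAt (by simp)), hτy]
  set J := fderiv ℝ τ y
  have hJinj : Function.Injective J := by
    rw [hXd] at hXinj
    exact Function.Injective.of_comp hXinj
  have hJsurj : LinearMap.range (J : E2 →ₗ[ℝ] E2) = ⊤ :=
    LinearMap.range_eq_top.2 (LinearMap.injective_iff_surjective.1 hJinj)
  have hrange : LinearMap.range (fderiv ℝ X y : E2 →ₗ[ℝ] E3) =
      LinearMap.range (fderiv ℝ A z : E2 →ₗ[ℝ] E3) := by
    rw [hXd]
    exact LinearMap.range_comp_of_range_eq_top _ hJsurj
  have hplane : tangentPlane x q = LinearMap.range (fderiv ℝ A z : E2 →ₗ[ℝ] E3) := by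
    rw [← span_range_clm_single]
    change Submodule.span ℝ (range fun i => coordDeriv A i z) = _
    simp only [coordDeriv_eq_fderiv _ _ hz]
  refine ⟨?_, ?_⟩
  · rw [hplane, ← hrange, ← span_range_clm_single]
    simp only [coordDeriv_eq_fderiv _ _ hy.2]
  · let P : E3 →L[ℝ] E3 := (tangentPlane x q)ᗮ.starProjection
    -- the normal part of the Hessian in the chart around `q`, as a bilinear map
    let B : E2 →L[ℝ] E2 →L[ℝ] E3 :=
      (ContinuousLinearMap.compL ℝ E2 E3 E3 P).comp (fderiv ℝ (fderiv ℝ A) z)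
    have hB : ∀ v w, B v w = P (fderiv ℝ (fderiv ℝ A) z v w) := fun v w => rfl
    have hDA : DifferentiableAt ℝ (fderiv ℝ A) z := by
      rw [← hτy]
      exact (hAsm.fderiv_right (m := ∞) (by simp)).differentiableAt (by simp)
    have h1 : meanCurvatureVector x q = ∑ i, ∑ j, (gramMatrix (fderiv ℝ A z))⁻¹ i j •
        B (EuclideanSpace.single i 1) (EuclideanSpace.single j 1) := by
      rw [meanCurvatureVector, metricMatrix_eq_gramMatrix x q hz]
      refine Finset.sum_congr rfl fun i _ => Finset.sum_congr rfl fun j _ => ?_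
      have h3 : ∀ v w : E2, fderiv ℝ (fun u => fderiv ℝ A u w) z v =
          fderiv ℝ (fderiv ℝ A) z v w := fun v w => by
        rw [(hDA.hasFDerivAt.clm_apply (hasFDerivAt_const w z)).fderiv]
        simp
      rw [secondFundamentalForm, coordDeriv_coordDeriv_eq _ _ _ hz, hB, h3]
      rfl
    have h2 : ∀ i j, normalPart x q (coordDeriv (coordDeriv X j) i y) =
        B (J (EuclideanSpace.single i 1)) (J (EuclideanSpace.single j 1)) := fun i j => by
      have hXτ' : (fun u => fderiv ℝ X u (EuclideanSpace.single j 1)) =ᶠ[𝓝 y]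
          fun u => fderiv ℝ (A ∘ τ) u (EuclideanSpace.single j 1) := by
        filter_upwards [hXτ.fderiv (𝕜 := ℝ)] with u hu
        rw [hu]
      rw [coordDeriv_coordDeriv_eq _ _ _ hy.2, hXτ'.fderiv_eq, fderiv_fderiv_comp_apply hAsm hτ,
        hτy, hB, normalPart, map_add]
      -- the second derivatives of the coordinate change only contribute tangentially
      have h0 : (tangentPlane x q)ᗮ.starProjection (fderiv ℝ A z
          (fderiv ℝ (fun u => fderiv ℝ τ u (EuclideanSpace.single j (1 : ℝ))) y
            (EuclideanSpace.single i 1))) = 0 := by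
        apply Submodule.starProjection_orthogonal_apply_eq_zero
        rw [hplane]
        exact ⟨_, rfl⟩
      rw [h0, add_zero]
    rw [h1, metricMatrix_eq_gramMatrix x p hy.2]
    simp only [h2]
    rw [← hX, hXd]
    exact (sum_gramMatrix_inv_comp (hXd ▸ hXinj) B).symm

end ChartChange

/-! ### Weak gradients and weak differential inequalities -/

section WeakForm

lemma coordDeriv_mul {f g : E2 → ℝ} {y : E2} {T : Set E2} (hT : IsRelOpen T)
    (hf : ContDiffOn ℝ ∞ f T) (hg : ContDiffOn ℝ ∞ g T) (i : Fin 2) (hy : y ∈ T) :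
    coordDeriv (fun z => f z * g z) i y = f y * coordDeriv g i y + g y * coordDeriv f i y := by
  rw [hT.coordDeriv_eq _ _ hy, hT.coordDeriv_eq _ _ hy, hT.coordDeriv_eq _ _ hy]
  change fderivWithin ℝ (f * g) T y _ = _
  rw [((hf.differentiableOn (by simp) y hy).hasFDerivWithinAt.mul
      (hg.differentiableOn (by simp) y hy).hasFDerivWithinAt).fderivWithin (hT.uniqueDiffOn y hy)]
  rfl

/-- A function that is smooth up to the boundary line has its classical gradient as weak gradient
in the open half-plane. -/
lemma IsRelOpen.isWeakGradient {T : Set E2} (hT : IsRelOpen T) {v : E2 → ℝ}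
    (hv : ContDiffOn ℝ ∞ v T) :
    IsWeakGradient (T ∩ interior (range (𝓡∂ 2))) v
      (fun y => WithLp.toLp 2 fun i => coordDeriv v i y) where
  memLp K hK hKc := by
    have hc : ContinuousOn (fun y => (WithLp.toLp 2 fun i => coordDeriv v i y : E2)) K := by
      have h : ContinuousOn (fun y => fun i => coordDeriv v i y) K :=
        continuousOn_pi.2 fun i =>
          (hT.contDiffOn_coordDeriv hv i).continuousOn.mono (hK.trans inter_subset_left)
      exact (PiLp.continuous_toLp 2 _).comp_continuousOn h
    obtain ⟨C, hC⟩ := hKc.exists_bound_of_continuousOn hc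
    have : IsFiniteMeasure (volume.restrict K) := ⟨by simpa using hKc.measure_lt_top⟩
    exact MemLp.of_bound (hc.aestronglyMeasurable hKc.measurableSet) C
      ((ae_restrict_iff' hKc.measurableSet).2 (Eventually.of_forall hC))
  integral_eq ψ hψ hψc hψU i := by
    have hKT : tsupport ψ ⊆ T := hψU.trans inter_subset_left
    have hψ0 : ∀ y ∉ tsupport ψ, ψ y = 0 := fun y hy => image_eq_zero_of_notMem_tsupport hy
    have h0 := hT.integral_divergence_eq_zero (fun k y => if k = i then v y * ψ y else 0)
      hψc.isCompact hKT ?_ ?_ ?_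
    · have hUm := hT.isOpen_inter_interior.measurableSet
      have hd : ∀ y ∈ T ∩ interior (range (𝓡∂ 2)),
          ∑ k, coordDeriv (fun y => if k = i then v y * ψ y else 0) k y =
            v y * fderiv ℝ ψ y (EuclideanSpace.single i 1) + coordDeriv v i y * ψ y := by
        intro y hy
        rw [Finset.sum_eq_single i]
        · simp only [if_true]
          rw [coordDeriv_mul hT hv hψ.contDiffOn i hy.1, coordDeriv_eq_fderiv ψ i hy.2]
          ring
        · intro k _ hk
          simp [hk, coordDeriv]
        · simp
      rw [setIntegral_congr_fun hUm hd, integral_add] at h0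
      · exact eq_neg_of_add_eq_zero_left h0
      · refine hT.integrableOn hψc.isCompact hKT (hv.continuousOn.mul ?_) fun y hy => ?_
        · exact ((hψ.continuous_fderiv (by simp)).clm_apply continuous_const).continuousOn
        · have h : ψ =ᶠ[𝓝 y] fun _ => (0 : ℝ) := by
            filter_upwards [(isClosed_tsupport ψ).isOpen_compl.mem_nhds hy.2] with z hz
              using hψ0 z hz
          rw [h.fderiv_eq]
          simp
      · refine hT.integrableOn hψc.isCompact hKT
          ((hT.contDiffOn_coordDeriv hv i).continuousOn.mul hψ.continuous.continuousOn)
          fun y hy => ?_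
        rw [hψ0 y hy.2, mul_zero]
    · intro k
      by_cases hk : k = i
      · simp only [hk, if_true]
        exact hv.mul hψ.contDiffOn
      · simp only [hk, if_false]
        exact contDiffOn_const
    · intro k y hy
      simp [hψ0 y hy.2]
    · intro y _ hy
      have : y ∉ tsupport ψ := fun h => (mem_interior_halfPlane.1 (hψU h).2).ne' hy
      simp [hψ0 y this]

/-- The weak form of a differential inequality `div G ≥ 0` for a field `G` that is smooth up to the
boundary line and vanishes there. -/
lemma IsRelOpen.integral_le_zero_of_divergence_nonneg {T : Set E2} (hT : IsRelOpen T)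
    {G : Fin 2 → E2 → ℝ} (hG : ∀ j, ContDiffOn ℝ ∞ (G j) T)
    (hbd : ∀ y ∈ T, y 0 = 0 → G 0 y = 0)
    (hdiv : ∀ y ∈ T ∩ interior (range (𝓡∂ 2)), 0 ≤ ∑ j, coordDeriv (G j) j y)
    {φ : E2 → ℝ} (hφ : ContDiffOn ℝ ∞ φ T) {K : Set E2} (hK : IsCompact K) (hKT : K ⊆ T)
    (hφK : ∀ y ∈ T \ K, φ y = 0) (hφ0 : ∀ y ∈ T, 0 ≤ φ y) :
    IntegrableOn (fun y => ∑ j, G j y * coordDeriv φ j y) (T ∩ interior (range (𝓡∂ 2))) ∧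
      ∫ y in T ∩ interior (range (𝓡∂ 2)), ∑ j, G j y * coordDeriv φ j y ≤ 0 := by
  have hUm := hT.isOpen_inter_interior.measurableSet
  have hi1 : IntegrableOn (fun y => ∑ j, G j y * coordDeriv φ j y)
      (T ∩ interior (range (𝓡∂ 2))) := by
    refine hT.integrableOn hK hKT (continuousOn_finsetSum _ fun j _ =>
      (hG j).continuousOn.mul (hT.contDiffOn_coordDeriv hφ j).continuousOn) fun y hy => ?_
    exact Finset.sum_eq_zero fun j _ => by
      rw [hT.coordDeriv_eq_zero hK.isClosed hφK j hy, mul_zero]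
  have hi2 : IntegrableOn (fun y => φ y * ∑ j, coordDeriv (G j) j y)
      (T ∩ interior (range (𝓡∂ 2))) := by
    refine hT.integrableOn hK hKT (hφ.continuousOn.mul (continuousOn_finsetSum _ fun j _ =>
      (hT.contDiffOn_coordDeriv (hG j) j).continuousOn)) fun y hy => ?_
    rw [hφK y hy, zero_mul]
  have h0 := hT.integral_divergence_eq_zero (fun j y => φ y * G j y) hK hKT
    (fun j => hφ.mul (hG j)) (fun j y hy => by simp [hφK y hy])
    (fun y hy h => by simp [hbd y hy h])
  have hd : ∀ y ∈ T ∩ interior (range (𝓡∂ 2)),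
      ∑ j, coordDeriv (fun y => φ y * G j y) j y =
        φ y * (∑ j, coordDeriv (G j) j y) + ∑ j, G j y * coordDeriv φ j y := by
    intro y hy
    rw [Finset.mul_sum, ← Finset.sum_add_distrib]
    exact Finset.sum_congr rfl fun j _ => coordDeriv_mul hT hφ (hG j) j hy.1
  rw [setIntegral_congr_fun hUm hd, integral_add hi2 hi1] at h0
  have hpos : 0 ≤ ∫ y in T ∩ interior (range (𝓡∂ 2)), φ y * ∑ j, coordDeriv (G j) j y :=
    setIntegral_nonneg hUm fun y hy => mul_nonneg (hφ0 y hy.1) (hdiv y hy)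
  exact ⟨hi1, by linarith⟩

end WeakForm

/-! ### The barrier function on a translator -/

section Barrier

variable {M : Type*} [TopologicalSpace M] [ChartedSpace (EuclideanHalfSpace 2) M]

open scoped InnerProductSpace

lemma det_metricMatrix (x : M → E3) (p : M) (y : E2) :
    (metricMatrix x p y).det =
      gramDet (coordDeriv (inChart x p) 0) (coordDeriv (inChart x p) 1) y := by
  rw [Matrix.det_fin_two, gramDet]
  simp only [metricMatrix, Matrix.of_apply]
  rw [real_inner_comm (coordDeriv (inChart x p) 0 y) (coordDeriv (inChart x p) 1 y)]
  ring

lemma inv_metricMatrix (x : M → E3) (p : M) (y : E2) :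
    (metricMatrix x p y)⁻¹ =
      (gramDet (coordDeriv (inChart x p) 0) (coordDeriv (inChart x p) 1) y)⁻¹ •
        !![⟪coordDeriv (inChart x p) 1 y, coordDeriv (inChart x p) 1 y⟫_ℝ,
          -⟪coordDeriv (inChart x p) 0 y, coordDeriv (inChart x p) 1 y⟫_ℝ;
          -⟪coordDeriv (inChart x p) 0 y, coordDeriv (inChart x p) 1 y⟫_ℝ,
          ⟪coordDeriv (inChart x p) 0 y, coordDeriv (inChart x p) 0 y⟫_ℝ] := by
  rw [Matrix.inv_def, Ring.inverse_eq_inv', det_metricMatrix, Matrix.adjugate_fin_two]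
  simp only [metricMatrix, Matrix.of_apply]
  rw [real_inner_comm (coordDeriv (inChart x p) 0 y) (coordDeriv (inChart x p) 1 y)]

variable [IsManifold (𝓡∂ 2) ∞ M] {x : M → E3}

lemma linearIndependent_coordDeriv (hsm : ContMDiff (𝓡∂ 2) 𝓘(ℝ, E3) ∞ x)
    (hinj : ∀ p, Function.Injective (mfderiv (𝓡∂ 2) 𝓘(ℝ, E3) x p)) {p : M} {y : E2}
    (hy : y ∈ (extChartAt (𝓡∂ 2) p).target) :
    LinearIndependent ℝ ![coordDeriv (inChart x p) 0 y, coordDeriv (inChart x p) 1 y] :=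
  linearIndependent_of_injective (injective_fderivWithin_inChart hsm hinj hy)

/-- In every preferred chart the coordinate vector fields of a translator satisfy
`Δ_g X = e₃^⊥`, in divergence form; they span the tangent plane. -/
lemma divergence_conormalField_translator (hx : IsTranslator x) {p : M} {y : E2}
    (hy : y ∈ interiorTarget p) :
    fderiv ℝ (conormalField (coordDeriv (inChart x p) 0) (coordDeriv (inChart x p) 1)) y
        (EuclideanSpace.single 0 1)
      + fderiv ℝ (conormalField (coordDeriv (inChart x p) 1) (coordDeriv (inChart x p) 0)) y
        (EuclideanSpace.single 1 1) =
      √(gramDet (coordDeriv (inChart x p) 0) (coordDeriv (inChart x p) 1) y) •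
        (tangentPlane x ((extChartAt (𝓡∂ 2) p).symm y))ᗮ.starProjection (stdVec 2) ∧
    tangentPlane x ((extChartAt (𝓡∂ 2) p).symm y) =
      Submodule.span ℝ {coordDeriv (inChart x p) 0 y, coordDeriv (inChart x p) 1 y} := by
  have hT := isRelOpen_target p
  obtain ⟨hplane, hH⟩ := meanCurvatureVector_inChart hx.smooth hx.immersion hy
  have hXsm := contDiffOn_inChart hx.smooth p
  have hX : ContDiffAt ℝ ∞ (inChart x p) y := hT.contDiffAt hXsm hy.1 hy.2
  have hd : ∀ i, DifferentiableAt ℝ (coordDeriv (inChart x p) i) y := fun i =>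
    (hT.contDiffAt (hT.contDiffOn_coordDeriv hXsm i) hy.1 hy.2).differentiableAt (by simp)
  have hlin := linearIndependent_coordDeriv hx.smooth hx.immersion hy.1
  have hD : 0 < gramDet (coordDeriv (inChart x p) 0) (coordDeriv (inChart x p) 1) y :=
    gram_det_pos hlin
  have hK : tangentPlane x ((extChartAt (𝓡∂ 2) p).symm y) =
      Submodule.span ℝ {coordDeriv (inChart x p) 0 y, coordDeriv (inChart x p) 1 y} := by
    rw [hplane]
    congr 1
    ext v
    simp [Fin.exists_fin_two, eq_comm]
  refine ⟨?_, hK⟩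
  have hDX : DifferentiableAt ℝ (fderiv ℝ (inChart x p)) y :=
    (hX.fderiv_right (m := ∞) (by simp)).differentiableAt (by simp)
  have hsecond : ∀ i j, fderiv ℝ (coordDeriv (inChart x p) j) y (EuclideanSpace.single i 1) =
      fderiv ℝ (fderiv ℝ (inChart x p)) y (EuclideanSpace.single i 1)
        (EuclideanSpace.single j 1) := fun i j => by
    rw [← coordDeriv_eq_fderiv _ _ hy.2, coordDeriv_coordDeriv_eq _ _ _ hy.2,
      (hDX.hasFDerivAt.clm_apply (hasFDerivAt_const _ y)).fderiv]
    simp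
  have hsymm : fderiv ℝ (coordDeriv (inChart x p) 0) y (EuclideanSpace.single 1 1) =
      fderiv ℝ (coordDeriv (inChart x p) 1) y (EuclideanSpace.single 0 1) := by
    rw [hsecond, hsecond]
    exact (hX.isSymmSndFDerivAt (by
      simpa using WithTop.coe_le_coe.2 (le_top : (2 : ℕ∞) ≤ ⊤))).eq _ _
  rw [divergence_conormalField (hd 0) (hd 1) hlin hK hsymm]
  rw [hx.meanCurvature_eq, inv_metricMatrix] at hH
  simp only [Fin.sum_univ_two, normalPart, coordDeriv_eq_fderiv _ _ hy.2] at hH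
  rw [hH]
  have hS := (Real.sqrt_pos.2 hD).ne'
  have hS2 : (√(gramDet (coordDeriv (inChart x p) 0) (coordDeriv (inChart x p) 1) y))⁻¹ =
      √(gramDet (coordDeriv (inChart x p) 0) (coordDeriv (inChart x p) 1) y) *
        (gramDet (coordDeriv (inChart x p) 0) (coordDeriv (inChart x p) 1) y)⁻¹ := by
    field_simp
    rw [Real.sq_sqrt hD.le]
  rw [hS2]
  simp only [coordDeriv_eq_fderiv _ _ hy.2, Matrix.smul_apply, Matrix.of_apply, Matrix.cons_val',
    Matrix.cons_val_zero, Matrix.cons_val_one, Matrix.cons_val_fin_one, smul_eq_mul]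
  module

/-- The coordinate fields `√(det g) g^{ij} ∂_i u` of the barrier function `u = (x₁ - c)² e^{x₃}`. -/
noncomputable def barrierField (x : M → E3) (c : ℝ) (p : M) : Fin 2 → E2 → ℝ :=
  ![fun y => ⟪conormalField (coordDeriv (inChart x p) 0) (coordDeriv (inChart x p) 1) y,
      barrierGradient c (inChart x p y)⟫_ℝ,
    fun y => ⟪conormalField (coordDeriv (inChart x p) 1) (coordDeriv (inChart x p) 0) y,
      barrierGradient c (inChart x p y)⟫_ℝ]

lemma contDiffOn_conormalField {a b : E2 → E3} {T : Set E2} (ha : ContDiffOn ℝ ∞ a T)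
    (hb : ContDiffOn ℝ ∞ b T) (hD : ∀ y ∈ T, 0 < gramDet a b y) :
    ContDiffOn ℝ ∞ (conormalField a b) T := by
  have hg : ContDiffOn ℝ ∞ (gramDet a b) T :=
    ((ha.inner ℝ ha).mul (hb.inner ℝ hb)).sub ((ha.inner ℝ hb).pow 2)
  exact ((hg.sqrt fun y hy => (hD y hy).ne').inv fun y hy => (Real.sqrt_pos.2 (hD y hy)).ne').smul
    (((hb.inner ℝ hb).smul ha).sub ((ha.inner ℝ hb).smul hb))

lemma contDiffOn_barrierField (hsm : ContMDiff (𝓡∂ 2) 𝓘(ℝ, E3) ∞ x)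
    (hinj : ∀ p, Function.Injective (mfderiv (𝓡∂ 2) 𝓘(ℝ, E3) x p)) (c : ℝ) (p : M) (j : Fin 2) :
    ContDiffOn ℝ ∞ (barrierField x c p j) (extChartAt (𝓡∂ 2) p).target := by
  have hT := isRelOpen_target p
  have hX := contDiffOn_inChart hsm p
  have hD : ∀ y ∈ (extChartAt (𝓡∂ 2) p).target,
      0 < gramDet (coordDeriv (inChart x p) 0) (coordDeriv (inChart x p) 1) y :=
    fun y hy => gram_det_pos (linearIndependent_coordDeriv hsm hinj hy)
  have hN : ContDiffOn ℝ ∞ (fun y => barrierGradient c (inChart x p y))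
      (extChartAt (𝓡∂ 2) p).target := (contDiff_barrierGradient c).comp_contDiffOn hX
  fin_cases j
  · exact (contDiffOn_conormalField (hT.contDiffOn_coordDeriv hX 0)
      (hT.contDiffOn_coordDeriv hX 1) hD).inner ℝ hN
  · exact (contDiffOn_conormalField (hT.contDiffOn_coordDeriv hX 1)
      (hT.contDiffOn_coordDeriv hX 0) fun y hy => by
        rw [gramDet_comm]; exact hD y hy).inner ℝ hN

lemma divergence_barrierField_nonneg (hx : IsTranslator x) (c : ℝ) {p : M} {y : E2}
    (hy : y ∈ interiorTarget p) : 0 ≤ ∑ j, coordDeriv (barrierField x c p j) j y := by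
  have hT := isRelOpen_target p
  have hXsm := contDiffOn_inChart hx.smooth p
  have hd : ∀ i, DifferentiableAt ℝ (coordDeriv (inChart x p) i) y := fun i =>
    (hT.contDiffAt (hT.contDiffOn_coordDeriv hXsm i) hy.1 hy.2).differentiableAt (by simp)
  obtain ⟨hdiv, hK⟩ := divergence_conormalField_translator hx hy
  have h := divergence_barrier_nonneg c
    (linearIndependent_coordDeriv hx.smooth hx.immersion hy.1) hK
    ((hT.contDiffAt hXsm hy.1 hy.2).differentiableAt (by simp)) (hd 0) (hd 1)
    (coordDeriv_eq_fderiv _ _ hy.2).symm (coordDeriv_eq_fderiv _ _ hy.2).symm hdiv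
  rw [Fin.sum_univ_two, coordDeriv_eq_fderiv _ _ hy.2, coordDeriv_eq_fderiv _ _ hy.2]
  exact h

/-- The integrand `g(∇u, ∇φ) dvol` for the barrier function `u = (x₁ - c)² e^{x₃}`. -/
lemma gradPairing_barrier (hsm : ContMDiff (𝓡∂ 2) 𝓘(ℝ, E3) ∞ x)
    (hinj : ∀ p, Function.Injective (mfderiv (𝓡∂ 2) 𝓘(ℝ, E3) x p)) (c : ℝ) (p : M)
    (φ : M → ℝ) {y : E2} (hy : y ∈ (extChartAt (𝓡∂ 2) p).target) :
    gradPairing x p (fun y => WithLp.toLp 2 fun i =>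
        coordDeriv (inChart (fun q => (x q 0 - c) ^ 2 * Real.exp (x q 2)) p) i y) φ y =
      ∑ j, barrierField x c p j y * coordDeriv (inChart φ p) j y := by
  have hT := isRelOpen_target p
  have hXd := (contDiffOn_inChart hsm p).differentiableOn (by simp) y hy
  have hD : 0 < gramDet (coordDeriv (inChart x p) 0) (coordDeriv (inChart x p) 1) y :=
    gram_det_pos (linearIndependent_coordDeriv hsm hinj hy)
  have hu : ∀ i, coordDeriv (inChart (fun q => (x q 0 - c) ^ 2 * Real.exp (x q 2)) p) i y =
      ⟪coordDeriv (inChart x p) i y, barrierGradient c (inChart x p y)⟫_ℝ := fun i => by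
    have h := fderiv_comp_fderivWithin y
      ((contDiff_barrier c).differentiable (by simp) (inChart x p y)) hXd (hT.uniqueDiffOn y hy)
    rw [hT.coordDeriv_eq _ _ hy, hT.coordDeriv_eq _ _ hy]
    change fderivWithin ℝ ((fun v : E3 => (v 0 - c) ^ 2 * Real.exp (v 2)) ∘ inChart x p) _ _ _ = _
    rw [h, ContinuousLinearMap.comp_apply, fderiv_barrier, real_inner_comm]
  have hS := (Real.sqrt_pos.2 hD).ne'
  have hS2 := Real.sq_sqrt hD.le
  rw [gradPairing, inv_metricMatrix, det_metricMatrix]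
  simp only [hu, Fin.sum_univ_two, barrierField, conormalField, gramDet_comm, inner_smul_left,
    inner_sub_left, RCLike.conj_to_real, Matrix.smul_apply, Matrix.of_apply, Matrix.cons_val',
    Matrix.cons_val_zero, Matrix.cons_val_one, Matrix.cons_val_fin_one, smul_eq_mul]
  rw [real_inner_comm (coordDeriv (inChart x p) 0 y) (coordDeriv (inChart x p) 1 y)]
  field_simp
  rw [hS2]
  ring

/-- If the boundary of a translator lies in the plane `{x₁ = c}`, then `(x₁ - c)² e^{x₃}` is
weakly subharmonic with Neumann boundary condition: it vanishes to second order on the boundary. -/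
lemma isWeakNeumannSubharmonic_barrier (hx : IsTranslator x) {c : ℝ}
    (hc : ∀ p ∈ (𝓡∂ 2).boundary M, x p 0 = c) :
    IsWeakNeumannSubharmonic x fun q => (x q 0 - c) ^ 2 * Real.exp (x q 2) := by
  intro p
  have hT := isRelOpen_target p
  have hu : ContDiffOn ℝ ∞ (inChart (fun q => (x q 0 - c) ^ 2 * Real.exp (x q 2)) p)
      (extChartAt (𝓡∂ 2) p).target :=
    (contDiff_barrier c).comp_contDiffOn (contDiffOn_inChart hx.smooth p)
  refine ⟨_, hT.isWeakGradient hu, fun φ hφ hφc hφs hφ0 => ?_⟩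
  rw [← extChartAt_source (𝓡∂ 2)] at hφs
  have hK : IsCompact (extChartAt (𝓡∂ 2) p '' tsupport φ) :=
    hφc.isCompact.image_of_continuousOn ((continuousOn_extChartAt p).mono hφs)
  have h := hT.integral_le_zero_of_divergence_nonneg
    (contDiffOn_barrierField hx.smooth hx.immersion c p) ?_
    (fun y hy => divergence_barrierField_nonneg hx c hy)
    (contDiffOn_inChart hφ p) hK ?_ ?_ (fun y _ => hφ0 _)
  · have heq : EqOn (fun y => ∑ j, barrierField x c p j y * coordDeriv (inChart φ p) j y)
        (gradPairing x p (fun y => WithLp.toLp 2 fun i =>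
          coordDeriv (inChart (fun q => (x q 0 - c) ^ 2 * Real.exp (x q 2)) p) i y) φ)
        ((extChartAt (𝓡∂ 2) p).target ∩ interior (range (𝓡∂ 2))) := fun y hy =>
      (gradPairing_barrier hx.smooth hx.immersion c p φ hy.1).symm
    exact ⟨(integrableOn_congr_fun heq hT.isOpen_inter_interior.measurableSet).1 h.1,
      (setIntegral_congr_fun hT.isOpen_inter_interior.measurableSet heq).symm.trans_le h.2⟩
  · intro y hy h0
    have h1 : inChart x p y 0 = c := hc _ ((symm_mem_boundary_iff hy).2 h0)
    simp [barrierField, barrierGradient, h1]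
  · rintro _ ⟨q, hq, rfl⟩
    exact (extChartAt (𝓡∂ 2) p).map_source (hφs hq)
  · intro y hy
    refine image_eq_zero_of_notMem_tsupport (f := φ) fun h => hy.2 ⟨_, h, ?_⟩
    exact (extChartAt (𝓡∂ 2) p).right_inv hy.1

end Barrier

/-! ### Intrinsic distance along the boundary -/

section Boundary

/-- The length of a monotone path in the line. -/
lemma lintegral_enorm_deriv_eq {h h' : ℝ → ℝ} {s t : ℝ} (hst : s ≤ t)
    (hd : ∀ u ∈ Icc s t, HasDerivAt h (h' u) u) (hc : ContinuousOn h' (Icc s t))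
    (hsign : (∀ u ∈ Icc s t, h' u < 0) ∨ ∀ u ∈ Icc s t, 0 < h' u) :
    ∫⁻ u in Icc s t, ‖h' u‖ₑ = ENNReal.ofReal |h t - h s| := by
  wlog hpos : ∀ u ∈ Icc s t, 0 < h' u generalizing h h'
  · have hneg := hsign.resolve_right hpos
    have := this (h := fun u => -h u) (h' := fun u => -h' u) (fun u hu => (hd u hu).neg) hc.neg
      (Or.inr fun u hu => neg_pos.2 (hneg u hu)) (fun u hu => neg_pos.2 (hneg u hu))
    simp only [enorm_neg] at this
    rw [this, ← abs_neg]
    congr 2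
    ring
  have hint : IntegrableOn h' (Icc s t) := hc.integrableOn_compact isCompact_Icc
  have h1 : ∫ u in Icc s t, h' u = h t - h s := by
    rw [integral_Icc_eq_integral_Ioc, ← intervalIntegral.integral_of_le hst]
    refine intervalIntegral.integral_eq_sub_of_hasDerivAt (fun u hu => hd u ?_) ?_
    · rwa [uIcc_of_le hst] at hu
    · exact ContinuousOn.intervalIntegrable (by rwa [uIcc_of_le hst])
  have hnn : 0 ≤ᵐ[volume.restrict (Icc s t)] h' :=
    (ae_restrict_iff' measurableSet_Icc).2 (Eventually.of_forall fun u hu => (hpos u hu).le)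
  have h2 : 0 ≤ h t - h s := h1 ▸ setIntegral_nonneg measurableSet_Icc fun u hu => (hpos u hu).le
  rw [abs_of_nonneg h2, ← h1, ofReal_integral_eq_lintegral_ofReal hint hnn]
  exact setLIntegral_congr_fun measurableSet_Icc fun u hu => by
    rw [Real.enorm_of_nonneg (hpos u hu).le]

variable {M : Type*} [TopologicalSpace M] [ChartedSpace (EuclideanHalfSpace 2) M]

/-- The extended norms on tangent spaces that define the intrinsic distance. -/
@[reducible] noncomputable def immersionENorm (x : M → E3) (r : M) :
    ENorm (TangentSpace (𝓡∂ 2) r) := ⟨tangentLength x r⟩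

lemma immersionENorm_smulClass (x : M → E3) (r : M) :
    letI := immersionENorm x r
    ENormSMulClass ℝ (TangentSpace (𝓡∂ 2) r) := by
  let _ := immersionENorm x r
  refine ⟨fun s v => ?_⟩
  change tangentLength x r (s • v) = _ * tangentLength x r v
  unfold tangentLength
  have h : mfderiv (𝓡∂ 2) 𝓘(ℝ, E3) x r (s • v) = s • mfderiv (𝓡∂ 2) 𝓘(ℝ, E3) x r v := map_smul _ _ _
  simp only [h]
  have key : ∀ w : E3, ‖s • w‖ₑ = ‖s‖ₑ * ‖w‖ₑ := fun w => enorm_smul s w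
  exact key _

variable [IsManifold (𝓡∂ 2) ∞ M]

omit [IsManifold (𝓡∂ 2) ∞ M] in
lemma intrinsicEDist_triangle (x : M → E3) (p q r : M) :
    intrinsicEDist x p r ≤ intrinsicEDist x p q + intrinsicEDist x q r := by
  let _ := immersionENorm x
  have := immersionENorm_smulClass x
  exact Manifold.riemannianEDist_triangle

omit [IsManifold (𝓡∂ 2) ∞ M] in
lemma intrinsicEDist_comm (x : M → E3) (p q : M) :
    intrinsicEDist x p q = intrinsicEDist x q p := by
  let _ := immersionENorm x
  have := immersionENorm_smulClass x
  exact Manifold.riemannianEDist_comm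

omit [IsManifold (𝓡∂ 2) ∞ M] in
/-- The intrinsic distance of the endpoints of a `C¹` path is at most the length of its image in
three-space. -/
lemma intrinsicEDist_le_lintegral {x : M → E3} (hx : MDifferentiable (𝓡∂ 2) 𝓘(ℝ, E3) x)
    {γ : ℝ → M} {s t : ℝ} (hst : s ≤ t)
    (hγ : ContMDiffOn 𝓘(ℝ, ℝ) (𝓡∂ 2) 1 γ (Icc s t)) {β' : ℝ → E3}
    (hβ : ∀ u ∈ Ioo s t, HasDerivAt (fun u => x (γ u)) (β' u) u) :
    intrinsicEDist x (γ s) (γ t) ≤ ∫⁻ u in Icc s t, ‖β' u‖ₑ := by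
  let _ := immersionENorm x
  have := immersionENorm_smulClass x
  refine (Manifold.riemannianEDist_le_pathELength hγ rfl rfl hst).trans_eq ?_
  rw [Manifold.pathELength_eq_lintegral_mfderiv_Ioo, restrict_Ioo_eq_restrict_Icc.symm]
  refine setLIntegral_congr_fun measurableSet_Ioo fun u hu => ?_
  have hγu : MDifferentiableAt 𝓘(ℝ, ℝ) (𝓡∂ 2) γ u :=
    ((hγ u (Ioo_subset_Icc_self hu)).contMDiffAt (Icc_mem_nhds hu.1 hu.2)).mdifferentiableAt
      (by simp)
  have h1 := mfderiv_comp u (hx (γ u)) hγu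
  have h2 : mfderiv 𝓘(ℝ, ℝ) 𝓘(ℝ, E3) (x ∘ γ) u (1 : ℝ) = β' u := by
    rw [mfderiv_eq_fderiv]
    exact (hβ u hu).deriv
  rw [h1] at h2
  change tangentLength x (γ u) (mfderiv 𝓘(ℝ, ℝ) (𝓡∂ 2) γ u (1 : ℝ)) = _
  unfold tangentLength
  rw [← h2]
  rfl

lemma norm_eq_abs_of_eq_zero {v : E3} (h0 : v 0 = 0) (h2 : v 2 = 0) : ‖v‖ = |v 1| := by
  rw [EuclideanSpace.norm_eq, Fin.sum_univ_three, h0, h2]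
  simp [Real.sqrt_sq_eq_abs]

/-- If the boundary of an immersed surface is mapped to a straight line parallel to `e₂`, then near
each boundary point the boundary is a curve on which the coordinate `x₂` is strictly monotone and
bounds the intrinsic distance. -/
lemma exists_boundary_curve {x : M → E3} (hsm : ContMDiff (𝓡∂ 2) 𝓘(ℝ, E3) ∞ x)
    (hinj : ∀ p, Function.Injective (mfderiv (𝓡∂ 2) 𝓘(ℝ, E3) x p)) {a c : ℝ}
    (hline : ∀ p ∈ (𝓡∂ 2).boundary M, x p 0 = c ∧ x p 2 = a) {p : M}
    (hp : p ∈ (𝓡∂ 2).boundary M) :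
    ∃ r > 0, ∃ γ : ℝ → M, γ 0 = p ∧ (∀ s ∈ Ioo (-r) r, γ s ∈ (𝓡∂ 2).boundary M) ∧
      (∀ᶠ q in 𝓝 p, q ∈ (𝓡∂ 2).boundary M → ∃ s ∈ Ioo (-r) r, γ s = q) ∧
      (∀ s ∈ Ioo (-r) r, ∀ t ∈ Ioo (-r) r,
        intrinsicEDist x (γ s) (γ t) ≤ ENNReal.ofReal |x (γ t) 1 - x (γ s) 1|) ∧
      (StrictMonoOn (fun s => x (γ s) 1) (Ioo (-r) r) ∨
        StrictAntiOn (fun s => x (γ s) 1) (Ioo (-r) r)) := by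
  have hT := isRelOpen_target p
  set T := (extChartAt (𝓡∂ 2) p).target
  set y₀ := extChartAt (𝓡∂ 2) p p
  have hy₀T : y₀ ∈ T := mem_extChartAt_target p
  have hy₀0 : y₀ 0 = 0 := (mem_boundary_iff (mem_extChartAt_source p)).1 hp
  obtain ⟨r, hr, hball⟩ := Metric.mem_nhdsWithin_iff.1 (hT.mem_nhdsWithin y₀ hy₀T)
  let e : E2 := EuclideanSpace.single 1 1
  let l : ℝ → E2 := fun s => y₀ + s • e
  have hl0 : ∀ s, l s 0 = 0 := fun s => by simp [l, e, hy₀0]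
  have hlT : ∀ s ∈ Ioo (-r) r, l s ∈ T := fun s hs => by
    refine hball ⟨?_, mem_halfPlane.2 (hl0 s).ge⟩
    rw [Metric.mem_ball, dist_eq_norm]
    simpa [l, e, norm_smul, abs_lt] using hs
  have hlsm : ContDiff ℝ ∞ l := contDiff_const.add (contDiff_id.smul contDiff_const)
  have hld : ∀ s, HasDerivAt l e s := fun s => by
    have h := ((hasDerivAt_id s).smul_const e).const_add y₀
    rwa [one_smul] at h
  set X := inChart x p
  have hXsm : ContDiffOn ℝ ∞ X T := contDiffOn_inChart hsm p
  let γ : ℝ → M := fun s => (extChartAt (𝓡∂ 2) p).symm (l s)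
  have hγb : ∀ s ∈ Ioo (-r) r, γ s ∈ (𝓡∂ 2).boundary M := fun s hs =>
    (symm_mem_boundary_iff (hlT s hs)).2 (hl0 s)
  -- the derivative of the image of the curve is a nonzero multiple of `e₂`
  let β' : ℝ → E3 := fun s => coordDeriv X 1 (l s)
  have hβ : ∀ s ∈ Ioo (-r) r, HasDerivAt (fun s => x (γ s)) (β' s) s := fun s hs => by
    have h1 := (hXsm.differentiableOn (by simp) _ (hlT s hs)).hasFDerivWithinAt
    have h2 := h1.comp_hasDerivWithinAt s (hld s).hasDerivWithinAt (t := T)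
      (s := Ioo (-r) r) (fun u hu => hlT u hu)
    rw [← hT.coordDeriv_eq X 1 (hlT s hs)] at h2
    exact h2.hasDerivAt (Ioo_mem_nhds hs.1 hs.2)
  have hcomp : ∀ i, ∀ s ∈ Ioo (-r) r, HasDerivAt (fun s => x (γ s) i) (β' s i) s :=
    fun i s hs => ((EuclideanSpace.proj i : E3 →L[ℝ] ℝ).hasFDerivAt.comp_hasDerivAt s (hβ s hs))
  have hconst : ∀ (i : Fin 3) (k : ℝ), (∀ s ∈ Ioo (-r) r, x (γ s) i = k) →
      ∀ s ∈ Ioo (-r) r, β' s i = 0 := fun i k hk s hs => by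
    refine (hcomp i s hs).unique ((hasDerivAt_const s k).congr_of_eventuallyEq ?_)
    filter_upwards [Ioo_mem_nhds hs.1 hs.2] with u hu using hk u hu
  have hβ0 := hconst 0 c fun s hs => (hline _ (hγb s hs)).1
  have hβ2 := hconst 2 a fun s hs => (hline _ (hγb s hs)).2
  have hβ1 : ∀ s ∈ Ioo (-r) r, β' s 1 ≠ 0 := fun s hs h => by
    have h1 : β' s = 0 := by
      ext i
      fin_cases i
      exacts [hβ0 s hs, h, hβ2 s hs]
    have h2 := injective_fderivWithin_inChart hsm hinj (hlT s hs) (h1.trans (map_zero _).symm)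
    have h3 := congrArg (fun v : E2 => v 1) h2
    simp at h3
  have hsign := hasDerivWithinAt_forall_lt_or_forall_gt_of_forall_ne (convex_Ioo (-r) r)
    (fun s hs => (hcomp 1 s hs).hasDerivWithinAt) hβ1
  have hcont : ContinuousOn (fun s => β' s 1) (Ioo (-r) r) :=
    (EuclideanSpace.proj 1 : E3 →L[ℝ] ℝ).continuous.comp_continuousOn
      ((hT.contDiffOn_coordDeriv hXsm 1).continuousOn.comp hlsm.continuous.continuousOn hlT)
  have hdist : ∀ s ∈ Ioo (-r) r, ∀ t ∈ Ioo (-r) r, s ≤ t →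
      intrinsicEDist x (γ s) (γ t) ≤ ENNReal.ofReal |x (γ t) 1 - x (γ s) 1| := by
    intro s hs t ht hst
    have hsub : Icc s t ⊆ Ioo (-r) r := fun u hu => ⟨hs.1.trans_le hu.1, hu.2.trans_lt ht.2⟩
    have hγsm : ContMDiffOn 𝓘(ℝ, ℝ) (𝓡∂ 2) 1 γ (Icc s t) :=
      ((contMDiffOn_extChartAt_symm (I := 𝓡∂ 2) (n := ∞) p).of_le (by simp)).comp
        ((contMDiff_iff_contDiff.2 (hlsm.of_le (by simp))).contMDiffOn) fun u hu => hlT u (hsub hu)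
    refine (intrinsicEDist_le_lintegral (hsm.mdifferentiable (by simp)) hst hγsm
      fun u hu => hβ u (hsub (Ioo_subset_Icc_self hu))).trans_eq ?_
    rw [← lintegral_enorm_deriv_eq hst (fun u hu => hcomp 1 u (hsub hu)) (hcont.mono hsub)
      (hsign.imp (fun h u hu => h u (hsub hu)) (fun h u hu => h u (hsub hu)))]
    refine setLIntegral_congr_fun measurableSet_Icc fun u hu => ?_
    rw [← ofReal_norm, ← ofReal_norm,
      norm_eq_abs_of_eq_zero (hβ0 u (hsub hu)) (hβ2 u (hsub hu)), Real.norm_eq_abs]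
  refine ⟨r, hr, γ, ?_, hγb, ?_, ?_, ?_⟩
  · change (extChartAt (𝓡∂ 2) p).symm (y₀ + (0 : ℝ) • e) = p
    rw [zero_smul, add_zero]
    exact extChartAt_to_inv p
  · have hnear : ∀ᶠ q in 𝓝 p, extChartAt (𝓡∂ 2) p q ∈ Metric.ball y₀ r :=
      (continuousAt_extChartAt p).eventually (Metric.ball_mem_nhds _ hr)
    filter_upwards [hnear, extChartAt_source_mem_nhds (I := 𝓡∂ 2) p] with q hq hqs hqb
    have hq0 := (mem_boundary_iff hqs).1 hqb
    have hql : l (extChartAt (𝓡∂ 2) p q 1 - y₀ 1) = extChartAt (𝓡∂ 2) p q := by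
      ext i
      fin_cases i
      · exact (hl0 _).trans hq0.symm
      · simp [l, e]
    refine ⟨extChartAt (𝓡∂ 2) p q 1 - y₀ 1, ?_, ?_⟩
    · rw [mem_Ioo, ← abs_lt]
      rw [Metric.mem_ball, dist_eq_norm] at hq
      exact (PiLp.norm_apply_le (extChartAt (𝓡∂ 2) p q - y₀) 1).trans_lt hq
    · change (extChartAt (𝓡∂ 2) p).symm (l _) = q
      rw [hql, (extChartAt (𝓡∂ 2) p).left_inv hqs]
  · intro s hs t ht
    rcases le_total s t with hst | hst
    · exact hdist s hs t ht hst
    · rw [intrinsicEDist_comm, abs_sub_comm]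
      exact hdist t ht s hs hst
  · have hcts : ContinuousOn (fun s => x (γ s) 1) (Ioo (-r) r) := fun s hs =>
      (hcomp 1 s hs).continuousAt.continuousWithinAt
    rcases hsign with h | h
    · right
      refine strictAntiOn_of_deriv_neg (convex_Ioo _ _) hcts fun s hs => ?_
      rw [interior_Ioo] at hs
      rw [(hcomp 1 s hs).deriv]
      exact h s hs
    · left
      refine strictMonoOn_of_deriv_pos (convex_Ioo _ _) hcts fun s hs => ?_
      rw [interior_Ioo] at hs
      rw [(hcomp 1 s hs).deriv]
      exact h s hs

end Boundary

/-! ### Unboundedness of the boundary -/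

/-- A variational principle in the spirit of Ekeland and of Brezis and Browder. On a complete set
where every point `p` admits a point `r` with `d p r ≤ f r - f p` and `f p < f r`, the function `f`
is unbounded above: otherwise a maximizing sequence for the order `d p r ≤ f r - f p` converges to
a maximal point. -/
lemma not_bddAbove_of_exists_increase {M : Type*} [TopologicalSpace M] {d : M → M → ENNReal}
    (hself : ∀ p, d p p = 0) (hcomm : ∀ p q, d p q = d q p)
    (htri : ∀ p q r, d p r ≤ d p q + d q r)
    (hcomplete : ∀ s : ℕ → M,
      (∀ ε : ENNReal, 0 < ε → ∃ N, ∀ k, N ≤ k → ∀ l, N ≤ l → d (s k) (s l) < ε) →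
      ∃ q, Tendsto s atTop (𝓝 q))
    {S : Set M} (hS : IsClosed S) (hSne : S.Nonempty) {f : M → ℝ} (hf : Continuous f)
    (hlocal : ∀ p ∈ S, ∀ᶠ q in 𝓝 p, q ∈ S → d q p ≤ ENNReal.ofReal |f p - f q|)
    (hinc : ∀ p ∈ S, ∃ r ∈ S, d p r ≤ ENNReal.ofReal (f r - f p) ∧ f p < f r) :
    ¬ BddAbove (f '' S) := by
  intro hbdd
  have hR_trans : ∀ p q r, f p ≤ f q → f q ≤ f r → d p q ≤ ENNReal.ofReal (f q - f p) →
      d q r ≤ ENNReal.ofReal (f r - f q) → d p r ≤ ENNReal.ofReal (f r - f p) := by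
    intro p q r hpq hqr h1 h2
    refine (htri p q r).trans ((add_le_add h1 h2).trans_eq ?_)
    rw [← ENNReal.ofReal_add (by linarith) (by linarith)]
    congr 1
    ring
  -- each `p` admits a step to some `q` gaining at least half of the possible increase
  have hstep : ∀ p : S, ∃ q : S, (d p q ≤ ENNReal.ofReal (f q - f p) ∧ f p < f q) ∧
      ∀ r ∈ S, d p r ≤ ENNReal.ofReal (f r - f p) → f r ≤ f q + (f q - f p) := by
    intro p
    obtain ⟨r₀, hr₀, hr₀d, hr₀f⟩ := hinc p p.2
    let A : Set ℝ := f '' {r | r ∈ S ∧ d p r ≤ ENNReal.ofReal (f r - f p)}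
    have hA : BddAbove A := hbdd.mono (image_mono fun r hr => hr.1)
    have hAne : A.Nonempty := ⟨f r₀, r₀, ⟨hr₀, hr₀d⟩, rfl⟩
    have hlt : (f p + sSup A) / 2 < sSup A := by
      have : f r₀ ≤ sSup A := le_csSup hA ⟨r₀, ⟨hr₀, hr₀d⟩, rfl⟩
      linarith
    obtain ⟨_, ⟨q, ⟨hqS, hqd⟩, rfl⟩, hq⟩ := exists_lt_of_lt_csSup hAne hlt
    refine ⟨⟨q, hqS⟩, ⟨hqd, ?_⟩, fun r hr hrd => ?_⟩
    · change f p < f q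
      linarith
    · have : f r ≤ sSup A := le_csSup hA ⟨r, ⟨hr, hrd⟩, rfl⟩
      change f r ≤ f q + (f q - f p)
      linarith
  choose g hg hgmax using hstep
  obtain ⟨p₀, hp₀⟩ := hSne
  let s : ℕ → S := fun k => g^[k] ⟨p₀, hp₀⟩
  have hs : ∀ k, s (k + 1) = g (s k) := fun k => Function.iterate_succ_apply' g k _
  have hmono : StrictMono fun k => f (s k) := strictMono_nat_of_lt_succ fun k => by
    rw [hs]
    exact (hg (s k)).2
  have hd : ∀ k l, k ≤ l → d (s k) (s l) ≤ ENNReal.ofReal (f (s l) - f (s k)) := by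
    intro k l hkl
    induction l, hkl using Nat.le_induction with
    | base => simp [hself]
    | succ l hkl ih =>
      refine hR_trans _ (s l) _ (hmono.monotone hkl) (hmono l.lt_succ_self).le ih ?_
      rw [hs]
      exact (hg (s l)).1
  have hbdd' : BddAbove (range fun k => f (s k)) := hbdd.mono (by
    rintro _ ⟨k, rfl⟩
    exact ⟨_, (s k).2, rfl⟩)
  have hlim := tendsto_atTop_ciSup hmono.monotone hbdd'
  set L := ⨆ k, f (s k) with hL
  have hleL : ∀ k, f (s k) ≤ L := fun k => le_ciSup hbdd' k
  obtain ⟨q, hq⟩ := hcomplete (fun k => s k) fun ε hε => by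
    have h0 : Tendsto (fun k => ENNReal.ofReal (L - f (s k))) atTop (𝓝 0) := by
      have := ENNReal.tendsto_ofReal (hlim.const_sub L)
      simpa using this
    obtain ⟨N, hN⟩ := (h0.eventually (gt_mem_nhds hε)).exists
    have key : ∀ k, N ≤ k → ∀ l, k ≤ l → d (s k) (s l) < ε := fun k hk l hkl => by
      refine (hd k l hkl).trans_lt (lt_of_le_of_lt (ENNReal.ofReal_le_ofReal ?_) hN)
      have h1 : f (s N) ≤ f (s k) := hmono.monotone hk
      have h2 := hleL l
      linarith
    refine ⟨N, fun k hk l hl => ?_⟩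
    rcases le_total k l with h | h
    · exact key k hk l h
    · rw [hcomm]
      exact key l hl k h
  have hqS : q ∈ S := hS.mem_of_tendsto hq (Eventually.of_forall fun k => (s k).2)
  have hfq : f q = L := tendsto_nhds_unique ((hf.tendsto q).comp hq) hlim
  have hkq : ∀ k, d (s k) q ≤ ENNReal.ofReal (f q - f (s k)) := fun k => by
    obtain ⟨l, hl, hkl⟩ := ((hq.eventually (hlocal q hqS)).and (eventually_ge_atTop k)).exists
    have h1 := hl (s l).2
    rw [abs_of_nonneg (by rw [hfq]; linarith [hleL l])] at h1
    exact hR_trans _ (s l) _ (hmono.monotone hkl) (by rw [hfq]; exact hleL l) (hd k l hkl) h1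
  obtain ⟨r, hrS, hrd, hrf⟩ := hinc q hqS
  have hle : ∀ k, f r ≤ f (s (k + 1)) + (f (s (k + 1)) - f (s k)) := fun k => by
    rw [hs]
    exact hgmax (s k) r hrS (hR_trans _ q _ (by rw [hfq]; exact hleL k) hrf.le (hkq k) hrd)
  have hlim1 := hlim.comp (tendsto_add_atTop_nat 1)
  have hfr : f r ≤ L + (L - L) := ge_of_tendsto' (hlim1.add (hlim1.sub hlim)) hle
  linarith

section

variable {M : Type*} [TopologicalSpace M] [ChartedSpace (EuclideanHalfSpace 2) M]
  [IsManifold (𝓡∂ 2) ∞ M]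

/-- By completeness, the boundary curves of a translator whose boundary lies in a straight line
parallel to `e₂` run along the whole line. -/
lemma not_bddAbove_boundary {x : M → E3} (hx : IsTranslator x)
    (hbdry : ((𝓡∂ 2).boundary M).Nonempty) {a c : ℝ}
    (hline : ∀ p ∈ (𝓡∂ 2).boundary M, x p 0 = c ∧ x p 2 = a) :
    ¬ BddAbove ((fun p => x p 1) '' (𝓡∂ 2).boundary M) := by
  refine not_bddAbove_of_exists_increase (d := intrinsicEDist x) (fun p => ?_)
    (intrinsicEDist_comm x) (intrinsicEDist_triangle x) hx.complete
    ((𝓡∂ 2).isClosed_boundary (n := ∞) (by simp)) hbdry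
    ((EuclideanSpace.proj 1 : E3 →L[ℝ] ℝ).continuous.comp hx.smooth.continuous) ?_ ?_
  · let _ := immersionENorm x
    have := immersionENorm_smulClass x
    exact Manifold.riemannianEDist_self
  · intro p hp
    obtain ⟨r, hr, γ, hγ0, -, hnear, hdist, -⟩ :=
      exists_boundary_curve hx.smooth hx.immersion hline hp
    have h0 : (0 : ℝ) ∈ Ioo (-r) r := ⟨neg_lt_zero.2 hr, hr⟩
    filter_upwards [hnear] with q hq hqb
    obtain ⟨t, ht, rfl⟩ := hq hqb
    rw [← hγ0]
    exact hdist t ht 0 h0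
  · intro p hp
    obtain ⟨r, hr, γ, hγ0, hγb, -, hdist, hmono⟩ :=
      exists_boundary_curve hx.smooth hx.immersion hline hp
    have h0 : (0 : ℝ) ∈ Ioo (-r) r := ⟨neg_lt_zero.2 hr, hr⟩
    have key : ∀ t ∈ Ioo (-r) r, x (γ 0) 1 < x (γ t) 1 → ∃ q ∈ (𝓡∂ 2).boundary M,
        intrinsicEDist x p q ≤ ENNReal.ofReal (x q 1 - x p 1) ∧ x p 1 < x q 1 := by
      intro t ht hlt
      refine ⟨γ t, hγb t ht, ?_, hγ0 ▸ hlt⟩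
      have h := hdist 0 h0 t ht
      rwa [abs_of_pos (sub_pos.2 hlt), hγ0] at h
    rcases hmono with h | h
    · have ht : r / 2 ∈ Ioo (-r) r := ⟨by linarith, by linarith⟩
      exact key _ ht (h h0 ht (by positivity))
    · have ht : -(r / 2) ∈ Ioo (-r) r := ⟨by linarith, by linarith⟩
      exact key _ ht (h ht h0 (by linarith))

/-- A vertical slab that contains the straight line swept out by the boundary is parallel to it. -/
lemma normal_eq_of_subset_slab {x : M → E3} (hx : IsTranslator x)
    (hbdry : ((𝓡∂ 2).boundary M).Nonempty) {n : E3} {b width : ℝ} (hn : ‖n‖ = 1)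
    (hn_horizontal : n 2 = 0) (hslab : ∀ p, x p ∈ verticalSlab n b width) {a c : ℝ}
    (hline : ∀ p ∈ (𝓡∂ 2).boundary M, x p 0 = c ∧ x p 2 = a) :
    n = stdVec 0 ∨ n = -stdVec 0 := by
  have hin : ∀ v : E3, inner ℝ n v = n 0 * v 0 + n 1 * v 1 := fun v => by
    simp [PiLp.inner_apply, Fin.sum_univ_three, hn_horizontal, mul_comm]
  have h1 : n 1 = 0 := by
    by_contra h1
    apply not_bddAbove_boundary hx hbdry hline
    rcases lt_or_gt_of_ne h1 with hneg | hpos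
    · refine ⟨(b - n 0 * c) / n 1, ?_⟩
      rintro _ ⟨p, hp, rfl⟩
      have h := (hslab p).1
      rw [hin, (hline p hp).1] at h
      rw [le_div_iff_of_neg hneg]
      linarith
    · refine ⟨(b + width - n 0 * c) / n 1, ?_⟩
      rintro _ ⟨p, hp, rfl⟩
      have h := (hslab p).2
      rw [hin, (hline p hp).1] at h
      rw [le_div_iff₀ hpos]
      linarith
  have h0 : n 0 ^ 2 = 1 := by
    have h := real_inner_self_eq_norm_sq n
    rw [hn, hin, h1] at h
    linarith
  rcases (by simpa using h0 : n 0 = 1 ∨ n 0 = -1) with h | h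
  · left
    ext i
    fin_cases i <;> simp [stdVec, h, h1, hn_horizontal]
  · right
    ext i
    fin_cases i <;> simp [stdVec, h, h1, hn_horizontal]

end

end Translator

theorem mainTheorem6 {M : Type*} [TopologicalSpace M] [T2Space M] [SecondCountableTopology M]
    [ConnectedSpace M] [ChartedSpace (EuclideanHalfSpace 2) M] [IsManifold (𝓡∂ 2) ∞ M]
    (x : M → Translator.E3) (hx : Translator.IsTranslator x)
    (hbdry : ((𝓡∂ 2).boundary M).Nonempty)
    (hpar : Translator.IsNeumannParabolic x)
    (n : Translator.E3) (b width : ℝ) (hn : ‖n‖ = 1) (hn_horizontal : n 2 = 0)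
    (hslab : ∀ p, x p ∈ Translator.verticalSlab n b width)
    (a c : ℝ) (hhalf : ∀ p, x p 2 ≤ a)
    (hline : ∀ p ∈ (𝓡∂ 2).boundary M, x p 0 = c ∧ x p 2 = a) :
    (∀ p, x p 0 = c) ∧ (n = Translator.stdVec 0 ∨ n = -Translator.stdVec 0) := by
  have hnormal :=
    Translator.normal_eq_of_subset_slab hx hbdry hn hn_horizontal hslab hline
  refine ⟨?_, hnormal⟩
  -- the coordinate `x₁` is bounded since the slab is parallel to `{x₁ = c}`
  have hbound : ∀ p, |x p 0| ≤ |b| + |b + width| := fun p => by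
    have h : |inner ℝ n (x p)| ≤ |b| + |b + width| := by
      have h1 := (hslab p).1
      have h2 := (hslab p).2
      rw [abs_le]
      constructor
      · linarith [neg_abs_le b, abs_nonneg (b + width)]
      · linarith [le_abs_self (b + width), abs_nonneg b]
    rcases hnormal with rfl | rfl
    · rwa [Translator.inner_stdVec_left] at h
    · rwa [inner_neg_left, Translator.inner_stdVec_left, abs_neg] at h
  have hbdd : BddAbove (range fun q => (x q 0 - c) ^ 2 * Real.exp (x q 2)) := by
    refine ⟨(|b| + |b + width| + |c|) ^ 2 * Real.exp a, ?_⟩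
    rintro _ ⟨q, rfl⟩
    have h1 : (x q 0 - c) ^ 2 ≤ (|b| + |b + width| + |c|) ^ 2 := by
      rw [← sq_abs (x q 0 - c)]
      gcongr
      exact (abs_sub _ _).trans (add_le_add (hbound q) le_rfl)
    have h2 : Real.exp (x q 2) ≤ Real.exp a := Real.exp_le_exp.2 (hhalf q)
    dsimp only
    gcongr
  obtain ⟨k, hk⟩ := hpar (fun q => (x q 0 - c) ^ 2 * Real.exp (x q 2))
    ((Translator.contDiff_barrier c).continuous.comp hx.smooth.continuous)
    (Translator.isWeakNeumannSubharmonic_barrier hx fun p hp => (hline p hp).1) hbdd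
  obtain ⟨p₀, hp₀⟩ := hbdry
  have hk0 : k = 0 := by
    rw [← hk p₀, (hline p₀ hp₀).1]
    simp
  intro p
  have h := hk p
  rw [hk0] at h
  have h1 := (mul_eq_zero.1 h).resolve_right (Real.exp_pos _).ne'
  exact sub_eq_zero.1 (pow_eq_zero_iff two_ne_zero |>.1 h1)
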